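/- Let $p$ be a prime and let $(S,\mathfrak n)$ be a regular local ring of characteristic $p$ that is $F$-finite, i.e. $F_*S$ is a finitely generated $S$-module. Let $J\subsetneq S$ be a proper ideal and let $R=S/J$, a local ring of dimension $d$ with residue field $k$. Here $F^e_*R$ denotes $R$ regarded as an $R$-module via the $e$-th iterate of Frobenius, $\alpha(R)=\log_p[k:k^p]$, and the $e$-th $F$-splitting number $a_e(R)$ is the maximal number of direct summands isomorphic to $R$ in a direct sum decomposition of $F^e_*R$ as an $R$-module. For an ideal $I$ of $S$, $I^{[p^e]}$ is the ideal generated by the $p^e$-th powers of the elements of $I$, and $I:I'=\{x\in S : xI'\subseteq I\}$. Then for every integer $e>0$ the following lengths are finite and $$\frac{a_e(R)}{p^{e\alpha(R)}}=\ell_S\Bigl(S\big/\bigl(\mathfrak n^{[p^e]}:(J^{[p^e]}:J)\bigr)\Bigr)=\ell_S\Bigl((J^{[p^e]}:J)\big/\bigl((J^{[p^e]}:J)\cap\mathfrak n^{[p^e]}\bigr)\Bigr).$$ Consequently the $F$-signature $s(R)=\lim_{e\to\infty} a_e(R)/p^{e(d+\alpha(R))}$ exists and $$s(R)=\lim_{e\to\infty}\frac{1}{p^{ed}}\,\ell_S\Bigl(S\big/\bigl(\mathfrak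 n^{[p^e]}:(J^{[p^e]}:J)\bigr)\Bigr)=\lim_{e\to\infty}\frac{1}{p^{ed}}\,\ell_S\Bigl((J^{[p^e]}:J)\big/\bigl((J^{[p^e]}:J)\cap\mathfrak n^{[p^e]}\bigr)\Bigr).$$ -/

import Mathlib

open Filter Topology IsLocalRing

/-- A nonzero quotient of a ring of prime characteristic `p` has characteristic `p`. -/
instance instCharPQuotientOfNontrivial {R : Type*} [CommRing R] (p : ℕ) [Fact p.Prime] [CharP R p]
    (I : Ideal R) [Nontrivial (R ⧸ I)] : CharP (R ⧸ I) p := by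
  refine (CharP.charP_iff_prime_eq_zero Fact.out).2 ?_
  rw [← map_natCast (Ideal.Quotient.mk I) p, CharP.cast_eq_zero, map_zero]

/-- The residue field of a local ring of prime characteristic `p` has characteristic `p`. -/
instance instCharPResidueField {R : Type*} [CommRing R] [IsLocalRing R] (p : ℕ) [Fact p.Prime]
    [CharP R p] : CharP (ResidueField R) p := by
  refine (CharP.charP_iff_prime_eq_zero Fact.out).2 ?_
  rw [← map_natCast (residue R) p, CharP.cast_eq_zero, map_zero]

/-- A nonzero quotient of a local ring is local. -/
instance instIsLocalRingQuotientOfNontrivial {R : Type*} [CommRing R] [IsLocalRing R]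
    (I : Ideal R) [Nontrivial (R ⧸ I)] : IsLocalRing (R ⧸ I) :=
  IsLocalRing.of_surjective' (Ideal.Quotient.mk I) Ideal.Quotient.mk_surjective

/-- `F^e_* R`: the abelian group `R`, regarded as an `R`-module by restriction of scalars along
the `e`-th iterate of Frobenius (see `FrobeniusPushforward.smul_def`). -/
def FrobeniusPushforward (_p _e : ℕ) (R : Type*) : Type _ := R

namespace FrobeniusPushforward

variable (p e : ℕ) (R : Type*) [CommRing R]

instance : AddCommGroup (FrobeniusPushforward p e R) := inferInstanceAs (AddCommGroup R)

/-- The element `F^e_* x` of `F^e_* R` corresponding to `x`. -/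
def of : R ≃+ FrobeniusPushforward p e R := AddEquiv.refl R

variable [ExpChar R p]

instance : Module R (FrobeniusPushforward p e R) :=
  Module.compHom R (iterateFrobenius R p e)

theorem smul_def (r x : R) : r • of p e R x = of p e R (r ^ p ^ e * x) := rfl

end FrobeniusPushforward

/-- A ring `R` of characteristic `p` is `F`-finite if `F_* R` is a finitely generated
`R`-module. -/
def IsFFinite (p : ℕ) (R : Type*) [CommRing R] [ExpChar R p] : Prop :=
  Module.Finite R (FrobeniusPushforward p 1 R)

/-- `α(R) = log_p [k : k ^ p]`, where `k` is the residue field of the local ring `R`. -/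
noncomputable def frobeniusAlpha (p : ℕ) [Fact p.Prime] (R : Type*) [CommRing R] [IsLocalRing R]
    [CharP R p] : ℝ :=
  Real.logb p (Module.finrank (frobenius (ResidueField R) p).fieldRange (ResidueField R))

/-- The `e`-th `F`-splitting number `a_e(R)`: the maximal number of summands isomorphic to `R` in a
direct sum decomposition of `F^e_* R` as an `R`-module, that is, the largest `a` for which
`F^e_* R ≃ R ^ a ⊕ M` for some `R`-module `M`. (Such an `M` is a submodule of `F^e_* R`, so it
can be taken in the universe of `R`.) -/
noncomputable def fSplittingNumber.{u} (p e : ℕ) (R : Type u) [CommRing R] [ExpChar R p] : ℕ :=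
  sSup {a : ℕ | ∃ (M : Type u) (_ : AddCommGroup M) (_ : Module R M),
    Nonempty (FrobeniusPushforward p e R ≃ₗ[R] (Fin a → R) × M)}

/-- `s` is the `F`-signature of the local ring `R`: with `d = dim R`, the sequence
`a_e(R) / p ^ (e (d + α(R)))` converges to `s` as `e → ∞`. -/
def IsFSignature (p : ℕ) [Fact p.Prime] (R : Type*) [CommRing R] [IsLocalRing R] [CharP R p]
    (s : ℝ) : Prop :=
  ∃ d : ℕ, ringKrullDim R = d ∧
    Tendsto (fun e : ℕ => (fSplittingNumber p e R : ℝ) /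
      (p : ℝ) ^ ((e : ℝ) * ((d : ℝ) + frobeniusAlpha p R))) atTop (𝓝 s)

/-- The Frobenius power `I ^ [p ^ e]`: the ideal generated by the `p ^ e`-th powers of the elements
of `I`. -/
def frobeniusPower (p e : ℕ) {S : Type*} [CommRing S] [ExpChar S p] (I : Ideal S) : Ideal S :=
  I.map (iterateFrobenius S p e)

/-- The ideal `J ^ [p ^ e] : J`. -/
def frobeniusColon (p e : ℕ) {S : Type*} [CommRing S] [ExpChar S p] (J : Ideal S) : Ideal S :=
  (frobeniusPower p e J).colon (J : Set S)

/-- The ideal `𝔫 ^ [p ^ e] : (J ^ [p ^ e] : J)`, where `𝔫` is the maximal ideal of `S`. -/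
def fedderIdeal (p e : ℕ) {S : Type*} [CommRing S] [IsLocalRing S] [ExpChar S p] (J : Ideal S) :
    Ideal S :=
  (frobeniusPower p e (maximalIdeal S)).colon (frobeniusColon p e J : Set S)

/-- The `S`-module `(J ^ [p ^ e] : J) / ((J ^ [p ^ e] : J) ∩ 𝔫 ^ [p ^ e])`. -/
abbrev FedderQuotient (p e : ℕ) {S : Type*} [CommRing S] [IsLocalRing S] [ExpChar S p]
    (J : Ideal S) : Type _ :=
  frobeniusColon p e J ⧸
    (frobeniusColon p e J ⊓ frobeniusPower p e (maximalIdeal S)).submoduleOf (frobeniusColon p e J)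

/-! ### Regular local rings: the maximal ideal is generated by a regular sequence. -/

section RegularLocal

open RingTheory.Sequence

/-! Write `q = p ^ e` and `κ = [k : k ^ p]`, and let `I_e ⊆ R` be the ideal of those `x` such that
every `R`-linear map `F^e_* R → R` sends `F^e_* x` into the maximal ideal. Splitting off a maximal
free summand shows that `F^e_*(R / I_e)` has `R`-length `a_e(R)`. A length over `F^e_* R` is
multiplied by `κ ^ e` when taken over `R`, and `κ ^ e = p ^ (e α(R))`, so the normalized splitting
number is `ℓ(R / I_e)`.

The ideal `I_e` is computed by Fedder's method. `F^e_* S` is free over `S`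
(`free_frobeniusAlgebra`), and `S / 𝔫^[q]` has an element lying in all its nonzero ideals, because
`𝔫^[q]` is generated by powers of a regular system of parameters. Hence a single functional `T`
generates `Hom_S(F^e_* S, S)` over `F^e_* S`. The functionals on `F^e_* R` are the reductions of `T
(c ·)` with `c ∈ J^[q] : J`, so the preimage of `I_e` in `S` is `𝔫^[q] : (J^[q] : J)`
(`comap_splittingIdeal`). The form `T (x y)` is perfect modulo `𝔫`; the resulting duality
(`length_quotient_colon_add`) gives the second length.

For the limit, if `R` is not reduced, `I_e = R` for `e > 0`. If `R` is reduced but not a domain,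
`I_e` contains the minimal primes and `ℓ(R / I_e) = O(q ^ (d - 1))`. If `R` is a domain, `F_* R` has
generic rank at most `κ p ^ d`, and `I_e^[p] ⊆ I_{e+1}`; comparing lengths gives `u (e + 1) ≤ u e +
C / p ^ e` for `u e = ℓ(R / I_e) / p ^ (e d)`. A nonnegative sequence that decreases up to a
geometric error converges. -/

theorem IsLocalRing.map_mk_maximalIdeal {R : Type*} [CommRing R] [IsLocalRing R] (I : Ideal R)
    [Nontrivial (R ⧸ I)] :
    (maximalIdeal R).map (Ideal.Quotient.mk I) = maximalIdeal (R ⧸ I) := by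
  refine eq_maximalIdeal ((Ideal.map_eq_top_or_isMaximal_of_surjective _
    Ideal.Quotient.mk_surjective (maximalIdeal.isMaximal R)).resolve_left fun h => ?_)
  have hI : I ≤ maximalIdeal R := le_maximalIdeal (Ideal.Quotient.nontrivial_iff.1 inferInstance)
  have := Ideal.comap_map_of_surjective (Ideal.Quotient.mk I) Ideal.Quotient.mk_surjective
    (maximalIdeal R)
  rw [h, Ideal.comap_top, ← RingHom.ker_eq_comap_bot, Ideal.mk_ker, sup_eq_left.2 hI] at this
  exact (maximalIdeal.isMaximal R).ne_top this.symm

/-- A regular parameter outside all minimal primes. -/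
theorem IsRegularLocalRing.exists_parameter (S : Type*) [CommRing S] [IsRegularLocalRing S]
    (h0 : (maximalIdeal S).spanFinrank ≠ 0) :
    ∃ x ∈ maximalIdeal S, x ∉ maximalIdeal S ^ 2 ∧ ∀ P ∈ minimalPrimes S, x ∉ P := by
  classical
  have hne : maximalIdeal S ≠ ⊥ := fun h => h0 (by rw [h, Submodule.spanFinrank_bot])
  have hfin := minimalPrimes.finite_of_isNoetherianRing S
  -- Prime avoidance tolerates the non-prime ideal `𝔪 ^ 2`; Nakayama excludes `𝔪 ≤ 𝔪 ^ 2`, and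
  -- positive dimension excludes that `𝔪` is a minimal prime.
  have key := (Ideal.subset_union_prime (s := insert (maximalIdeal S ^ 2) hfin.toFinset)
    (f := id) (I := maximalIdeal S) (maximalIdeal S ^ 2) (maximalIdeal S ^ 2) (by
      intro i hi hi' _
      have := Finset.mem_of_mem_insert_of_ne hi hi'
      exact (Ideal.IsMinimalPrime.isPrime (hfin.mem_toFinset.1 this)))).not.2 (by
      rintro ⟨I, hI, hle⟩
      rcases Finset.mem_insert.1 hI with rfl | hI
      · refine hne (Submodule.eq_bot_of_le_smul_of_le_jacobson_bot (maximalIdeal S) _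
          (IsNoetherian.noetherian _) ?_ (maximalIdeal_le_jacobson _))
        simpa [sq] using hle
      · have hI := hfin.mem_toFinset.1 hI
        have := Ideal.IsMinimalPrime.isPrime hI
        have hIm : I = maximalIdeal S := le_antisymm (le_maximalIdeal this.ne_top) hle
        subst hIm
        have h1 : (maximalIdeal S).height = 0 := Ideal.height_eq_zero_iff.2 hI
        have h2 := IsRegularLocalRing.spanFinrank_maximalIdeal (R := S)
        rw [← maximalIdeal_height_eq_ringKrullDim, h1] at h2
        exact h0 (by exact_mod_cast h2))
  obtain ⟨x, hx, hx'⟩ := Set.not_subset.1 key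
  simp only [Set.mem_iUnion, not_exists] at hx'
  refine ⟨x, hx, hx' _ (by simp), fun P hP => hx' P (by simp [hP])⟩

theorem IsRegularLocalRing.quotient_parameter (S : Type*) [CommRing S] [IsRegularLocalRing S]
    {x : S} (hx : x ∈ maximalIdeal S) (hx2 : x ∉ maximalIdeal S ^ 2) :
    IsRegularLocalRing (S ⧸ Ideal.span {x}) ∧ ∃ _ : IsLocalRing (S ⧸ Ideal.span {x}),
      (maximalIdeal (S ⧸ Ideal.span {x})).spanFinrank + 1 ≤ (maximalIdeal S).spanFinrank := by
  classical
  have hxne : Ideal.span {x} ≠ ⊤ := fun h => (maximalIdeal.isMaximal S).ne_top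
    (top_le_iff.1 (h ▸ (Ideal.span_singleton_le_iff_mem _).2 hx))
  have hnt : Nontrivial (S ⧸ Ideal.span {x}) := Ideal.Quotient.nontrivial_iff.2 hxne
  obtain ⟨t, ht, hspan⟩ := Submodule.FG.exists_span_finset_card_eq_spanFinrank
    (IsNoetherian.noetherian (maximalIdeal S))
  have hx' := hx
  rw [← hspan, Submodule.mem_span_finset] at hx'
  obtain ⟨a, -, ha⟩ := hx'
  -- Since `x ∉ 𝔪 ^ 2`, some coefficient is a unit, so `x` can replace the generator `y`.
  obtain ⟨y, hyt, hy⟩ : ∃ y ∈ t, IsUnit (a y) := by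
    by_contra! h
    refine hx2 (ha ▸ Ideal.sum_mem _ fun y hy => ?_)
    rw [sq, smul_eq_mul]
    exact Ideal.mul_mem_mul ((mem_maximalIdeal _).2 (h y hy)) (hspan ▸ Submodule.subset_span hy)
  have hyx : y ∈ Ideal.span {x} ⊔ Ideal.span (t.erase y : Set S) := by
    rw [← Ideal.unit_mul_mem_iff_mem _ hy]
    have : a y * y = x - ∑ z ∈ t.erase y, a z • z := by
      rw [← ha, ← Finset.add_sum_erase t _ hyt]; simp
    rw [this]
    refine Submodule.sub_mem _ (Ideal.mem_sup_left (Ideal.mem_span_singleton_self x))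
      (Ideal.mem_sup_right (Submodule.sum_mem _ fun z hz =>
        Submodule.smul_mem _ _ (Ideal.subset_span hz)))
  have hmax : maximalIdeal S ≤ Ideal.span {x} ⊔ Ideal.span (t.erase y : Set S) := by
    rw [← hspan]
    refine Submodule.span_le.2 fun z hz => ?_
    by_cases hzy : z = y
    · exact hzy ▸ hyx
    · exact Ideal.mem_sup_right (Ideal.subset_span (by
        simpa [hzy] using hz))
  have hgen : maximalIdeal (S ⧸ Ideal.span {x}) =
      Ideal.span ((t.erase y).image (Ideal.Quotient.mk (Ideal.span {x})) : Set _) := by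
    rw [← map_mk_maximalIdeal]
    refine le_antisymm ((Ideal.map_mono hmax).trans ?_) ?_
    · rw [Ideal.map_sup, Ideal.map_quotient_self, bot_sup_eq, Ideal.map_span, Finset.coe_image]
    · rw [Finset.coe_image, ← Ideal.map_span]
      refine Ideal.map_mono (Ideal.span_le.2 fun z hz => ?_)
      exact hspan ▸ Submodule.subset_span ((by simpa using hz : z ∈ t ∧ z ≠ y).1)
  have hle : (maximalIdeal (S ⧸ Ideal.span {x})).spanFinrank + 1 ≤
      (maximalIdeal S).spanFinrank := by
    rw [hgen, ← ht, ← Finset.card_erase_add_one hyt]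
    have := Submodule.spanFinrank_span_le_ncard_of_finite (R := S ⧸ Ideal.span {x})
      (((t.erase y).image (Ideal.Quotient.mk (Ideal.span {x}))).finite_toSet)
    rw [Set.ncard_coe_finset] at this
    exact Nat.add_le_add_right (this.trans Finset.card_image_le) 1
  refine ⟨.of_spanFinrank_maximalIdeal_le _ ?_, inferInstance, hle⟩
  -- The dimension drops by at most one while the number of generators drops by at least one; hence
  -- the quotient is again regular.
  have h1 : ringKrullDim S ≤ ringKrullDim (S ⧸ Ideal.span {x}) + (1 : ℕ) := by
    have := ringKrullDim_le_ringKrullDim_quotient_add_encard ({x} : Set S) (by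
      rw [IsLocalRing.ringJacobson_eq_maximalIdeal]; simpa using hx)
    simpa using this
  rw [← IsRegularLocalRing.spanFinrank_maximalIdeal] at h1
  have h2 : (((maximalIdeal (S ⧸ Ideal.span {x})).spanFinrank + 1 : ℕ) : WithBot ℕ∞) ≤
      ringKrullDim (S ⧸ Ideal.span {x}) + (1 : ℕ) := (Nat.cast_le.2 hle).trans h1
  push_cast at h2
  exact (ENat.WithBot.add_le_add_natCast_right_iff (c := 1)).1 (by simpa using h2)

/-- Induction on a bound for the embedding dimension. By induction `S / x` is a domain, so `(x)` is
prime and contains a minimal prime `P`. As `x ∉ P`, each element of `P` is `x` times an element of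
`P`, and Nakayama gives `P = 0`. Then `x` is a nonzerodivisor, and a lifted regular sequence of `S /
x` completes it. -/
theorem IsRegularLocalRing.isDomain_and_exists_isWeaklyRegular (n : ℕ) :
    ∀ (S : Type*) [CommRing S] [IsRegularLocalRing S], (maximalIdeal S).spanFinrank ≤ n →
      IsDomain S ∧ ∃ L : List S, IsWeaklyRegular S L ∧ Ideal.ofList L = maximalIdeal S := by
  induction n with
  | zero =>
    intro S _ _ h
    have hbot : maximalIdeal S = ⊥ := (Submodule.spanFinrank_eq_zero_iff_eq_bot
      (IsNoetherian.noetherian _)).1 (Nat.le_zero.1 h)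
    let := ((isField_iff_maximalIdeal_eq (R := S)).2 hbot).toField
    exact ⟨inferInstance, [], .nil _ _, by simp [hbot]⟩
  | succ n ih =>
    intro S _ _ h
    by_cases h0 : (maximalIdeal S).spanFinrank = 0
    · exact ih S (by omega)
    obtain ⟨x, hx, hx2, hxP⟩ := exists_parameter S h0
    obtain ⟨hreg, hloc, hle⟩ := quotient_parameter S hx hx2
    obtain ⟨hdom, L, hL, hLm⟩ := ih (S ⧸ Ideal.span {x}) (by omega)
    have hprime : (Ideal.span {x}).IsPrime := (Ideal.Quotient.isDomain_iff_prime _).1 hdom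
    obtain ⟨P, hP, hPx⟩ := Ideal.exists_minimalPrimes_le (I := (⊥ : Ideal S))
      (J := Ideal.span {x}) bot_le
    have hPprime : P.IsPrime := Ideal.IsMinimalPrime.isPrime hP
    have hP0 : P = ⊥ := by
      refine Submodule.eq_bot_of_le_smul_of_le_jacobson_bot (Ideal.span {x}) _
        (IsNoetherian.noetherian _) (fun z hz => ?_)
        ((le_maximalIdeal hprime.ne_top).trans (maximalIdeal_le_jacobson _))
      obtain ⟨r, rfl⟩ := Ideal.mem_span_singleton'.1 (hPx hz)
      have hr : r ∈ P := (hPprime.mem_or_mem hz).resolve_right (hxP P hP)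
      rw [mul_comm, smul_eq_mul]
      exact Ideal.mul_mem_mul (Ideal.mem_span_singleton_self x) hr
    have hS : IsDomain S := by
      rw [hP0] at hPprime
      exact IsDomain.of_bot_isPrime S
    refine ⟨hS, ?_⟩
    obtain ⟨L', rfl⟩ : ∃ L' : List S, L'.map (Ideal.Quotient.mk (Ideal.span {x})) = L :=
      List.map_surjective_iff.2 Ideal.Quotient.mk_surjective L
    have hx0 : x ≠ 0 := fun h => hx2 (h ▸ zero_mem _)
    refine ⟨x :: L', (isWeaklyRegular_cons_iff S x L').2 ⟨?_, ?_⟩, ?_⟩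
    · exact fun a b hab => mul_left_cancel₀ hx0 hab
    · have := (isWeaklyRegular_map_algebraMap_iff (R := S) (S ⧸ Ideal.span {x})
        (S ⧸ Ideal.span {x}) L').1 hL
      refine ((Submodule.quotEquivOfEq _ _ ?_).isWeaklyRegular_congr L').2 this
      rw [← Submodule.ideal_span_singleton_smul, smul_eq_mul, Ideal.mul_top]
    · have h1 := congrArg (Ideal.comap (Ideal.Quotient.mk (Ideal.span {x}))) hLm
      rw [← Ideal.map_ofList] at h1
      have hnt : Nontrivial (S ⧸ Ideal.span {x}) := hdom.toNontrivial
      rw [← map_mk_maximalIdeal, Ideal.comap_map_of_surjective _ Ideal.Quotient.mk_surjective,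
        Ideal.comap_map_of_surjective _ Ideal.Quotient.mk_surjective,
        ← RingHom.ker_eq_comap_bot, Ideal.mk_ker,
        sup_eq_left.2 (le_maximalIdeal hprime.ne_top)] at h1
      rw [Ideal.ofList_cons, sup_comm, h1]

theorem IsRegularLocalRing.exists_isRegular (S : Type*) [CommRing S] [IsRegularLocalRing S] :
    ∃ L : List S, IsRegular S L ∧ Ideal.ofList L = maximalIdeal S := by
  obtain ⟨-, L, hL, hLm⟩ := isDomain_and_exists_isWeaklyRegular _ S le_rfl
  exact ⟨L, .of_isWeaklyRegular_of_mem_maximalIdeal S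
    (fun r hr => hLm ▸ Ideal.subset_span hr) hL, hLm⟩

end RegularLocal

/-! ### Powers of parameters and simple socles. -/

section SimpleSocle

open RingTheory.Sequence

/-- The class of `u` modulo `I` is nonzero and lies in every nonzero ideal of the quotient by
`I`. -/
def Ideal.IsEssentialElement {S : Type*} [CommRing S] (I : Ideal S) (u : S) : Prop :=
  u ∉ I ∧ ∀ s ∉ I, u ∈ I ⊔ Ideal.span {s}

theorem IsLocalRing.isEssentialElement_maximalIdeal (S : Type*) [CommRing S] [IsLocalRing S] :
    (maximalIdeal S).IsEssentialElement 1 := by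
  refine ⟨(Ideal.ne_top_iff_one _).1 (maximalIdeal.isMaximal S).ne_top,
    fun s hs => ?_⟩
  rw [Ideal.span_singleton_eq_top.2 (notMem_maximalIdeal.1 hs), sup_top_eq]
  trivial

/-- The socle of the thickened quotient is `x ^ a` times the old one: dividing `s` by the highest
power of `x` that it contains modulo `I` reduces to the quotient by `I + (x)`. -/
theorem Ideal.IsEssentialElement.sup_span_pow {S : Type*} [CommRing S] {I : Ideal S} {x u : S}
    (hx : ∀ r, x * r ∈ I → r ∈ I) (h : (I ⊔ Ideal.span {x}).IsEssentialElement u) (a : ℕ) :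
    (I ⊔ Ideal.span {x ^ (a + 1)}).IsEssentialElement (x ^ a * u) := by
  have hxa : ∀ n r, x ^ n * r ∈ I → r ∈ I := by
    intro n
    induction n with
    | zero => simp
    | succ n ih => exact fun r hr => ih r (hx _ (by rwa [← mul_assoc, ← pow_succ']))
  have mem : ∀ {y z : S}, z ∈ I ⊔ Ideal.span {y} ↔ ∃ t, z - t * y ∈ I := by
    intro y z
    rw [sup_comm, Ideal.mem_span_singleton_sup]
    constructor
    · rintro ⟨t, b, hb, rfl⟩; exact ⟨t, by simpa using hb⟩
    · rintro ⟨t, ht⟩; exact ⟨t, _, ht, by ring⟩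
  have mem' : ∀ {y s z : S}, (∃ t c, z - t * s - c * y ∈ I) →
      z ∈ I ⊔ Ideal.span {y} ⊔ Ideal.span {s} := by
    rintro y s z ⟨t, c, hc⟩
    have heq : z = (z - t * s - c * y) + c * y + t * s := by ring
    rw [heq]
    exact Submodule.add_mem_sup (Submodule.add_mem_sup hc
      (Ideal.mul_mem_left _ _ (Ideal.mem_span_singleton_self y)))
      (Ideal.mul_mem_left _ _ (Ideal.mem_span_singleton_self s))
  refine ⟨fun hmem => h.1 ?_, fun s hs => ?_⟩
  · obtain ⟨t, ht⟩ := mem.1 hmem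
    refine mem.2 ⟨t, hxa a _ ?_⟩
    convert ht using 1; ring
  -- `j` is the order of `s` along `x` modulo `I`; it is at most `a` because `s ∉ I + (x ^ (a +
  -- 1))`.
  · obtain ⟨j, hja, hj, hj'⟩ : ∃ j ≤ a, s ∈ I ⊔ Ideal.span {x ^ j} ∧
        s ∉ I ⊔ Ideal.span {x ^ (j + 1)} := by
      by_contra! hcon
      have : ∀ j ≤ a + 1, s ∈ I ⊔ Ideal.span {x ^ j} := by
        intro j
        induction j with
        | zero => simp
        | succ j ih => exact fun hj => hcon j (by omega) (ih (by omega))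
      exact hs (this _ le_rfl)
    obtain ⟨s', hs'⟩ := mem.1 hj
    have hs'x : s' ∉ I ⊔ Ideal.span {x} := by
      intro hmem
      obtain ⟨t, ht⟩ := mem.1 hmem
      refine hj' (mem.2 ⟨t, ?_⟩)
      have heq : s - t * x ^ (j + 1) = (s - s' * x ^ j) + x ^ j * (s' - t * x) := by ring
      exact heq ▸ I.add_mem hs' (I.mul_mem_left (x ^ j) ht)
    obtain ⟨b, rfl⟩ := Nat.exists_eq_add_of_le hja
    obtain ⟨c, t, hc⟩ : ∃ c t, u - t * s' - c * x ∈ I := by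
      have := h.2 s' hs'x
      rw [sup_comm, Ideal.mem_span_singleton_sup] at this
      obtain ⟨t, b, hb, rfl⟩ := this
      obtain ⟨c, hc⟩ := mem.1 hb
      exact ⟨c, t, by simpa using hc⟩
    have heq : x ^ (j + b) * u - t * x ^ b * s - c * x ^ (j + b + 1) =
        x ^ (j + b) * (u - t * s' - c * x) - t * x ^ b * (s - s' * x ^ j) := by ring
    have hmem := I.sub_mem (I.mul_mem_left (x ^ (j + b)) hc) (I.mul_mem_left (t * x ^ b) hs')
    rw [← heq] at hmem
    exact mem' ⟨t * x ^ b, c, hmem⟩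

variable {S : Type*} [CommRing S] [IsLocalRing S] [IsNoetherianRing S]

/-- Over a Noetherian local ring regular sequences may be permuted, and the last entry may be
replaced by a power. -/
theorem RingTheory.Sequence.IsWeaklyRegular.rotate_pow {x : S} {L : List S}
    (h : IsWeaklyRegular S (x :: L)) (hm : ∀ r ∈ x :: L, r ∈ maximalIdeal S) (a : ℕ) :
    IsWeaklyRegular S (L ++ [x ^ a]) ∧ ∀ r, x * r ∈ Ideal.ofList L → r ∈ Ideal.ofList L := by
  have h1 : IsWeaklyRegular S (L ++ [x]) := isWeaklyRegular_of_perm_of_subset_maximalIdeal h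
    (List.perm_append_comm (l₁ := [x])) hm
  rw [isWeaklyRegular_append_iff, isWeaklyRegular_singleton_iff] at h1
  refine ⟨(isWeaklyRegular_append_iff _ _ _).2 ⟨h1.1, (isWeaklyRegular_singleton_iff _ _).2
    (h1.2.pow a)⟩, fun r hr => ?_⟩
  have := h1.2.right_eq_zero_of_smul (x := Submodule.Quotient.mk r) (by
    rw [← Submodule.Quotient.mk_smul, Submodule.Quotient.mk_eq_zero]
    simpa using hr)
  rw [Submodule.Quotient.mk_eq_zero] at this
  simpa using this

/-- The list acts as a queue: the head is raised to its power and moved to the end, where both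
regularity and the socle element are controlled. `L₂` carries the entries already treated. -/
theorem RingTheory.Sequence.IsWeaklyRegular.append_map_pow (q : ℕ) (L₁ : List S) :
    ∀ L₂ : List S, IsWeaklyRegular S (L₁ ++ L₂) → (∀ r ∈ L₁ ++ L₂, r ∈ maximalIdeal S) →
      (∃ u, (Ideal.ofList (L₁ ++ L₂)).IsEssentialElement u) →
      IsWeaklyRegular S (L₂ ++ L₁.map (· ^ (q + 1))) ∧
        ∃ u, (Ideal.ofList (L₂ ++ L₁.map (· ^ (q + 1)))).IsEssentialElement u := by
  induction L₁ with
  | nil => intro L₂ h _ hu; simpa using And.intro h hu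
  | cons x L₁ ih =>
    rintro L₂ h hm ⟨u, hu⟩
    obtain ⟨h1, h2⟩ := h.rotate_pow hm (q + 1)
    have := ih (L₂ ++ [x ^ (q + 1)]) (by simpa using h1) (fun r hr => ?_) ⟨x ^ q * u, ?_⟩
    · simpa using this
    · simp only [List.mem_append, List.mem_singleton] at hr
      rcases hr with hr | hr | rfl
      · exact hm _ (by simp [hr])
      · exact hm _ (by simp [hr])
      · exact Ideal.pow_mem_of_mem _ (hm x (by simp)) _ (by omega)
    · rw [← List.append_assoc, Ideal.ofList_append, Ideal.ofList_singleton]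
      refine Ideal.IsEssentialElement.sup_span_pow h2 ?_ q
      rwa [List.cons_append, Ideal.ofList_cons, sup_comm] at hu

/-- In a regular local ring, the powers of a regular system of parameters form a regular sequence
and generate an irreducible ideal. -/
theorem IsRegularLocalRing.exists_regular_parameters (S : Type*) [CommRing S]
    [IsRegularLocalRing S] : ∃ L : List S, Ideal.ofList L = maximalIdeal S ∧
      ∀ q ≠ 0, IsWeaklyRegular S (L.map (· ^ q)) ∧
        ∃ u, (Ideal.ofList (L.map (· ^ q))).IsEssentialElement u := by
  obtain ⟨L, hL, hLm⟩ := IsRegularLocalRing.exists_isRegular S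
  refine ⟨L, hLm, fun q hq => ?_⟩
  obtain ⟨q, rfl⟩ := Nat.exists_eq_succ_of_ne_zero hq
  have := IsWeaklyRegular.append_map_pow q L []
    (by rw [List.append_nil]; exact hL.toIsWeaklyRegular)
    (fun r hr => hLm.le (Ideal.subset_span (by rwa [List.append_nil] at hr)))
    ⟨1, by simpa [hLm] using isEssentialElement_maximalIdeal S⟩
  simpa using this

end SimpleSocle

/-! ### A freeness criterion by regular sequences. -/

section Free

open RingTheory.Sequence

/-- A finite module over a Noetherian local ring is free if the maximal ideal is generated by a
regular sequence on it. -/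
theorem Module.free_of_isWeaklyRegular (n : ℕ) : ∀ (A : Type*) [CommRing A] [IsLocalRing A]
    [IsNoetherianRing A] (M : Type*) [AddCommGroup M] [Module A M] [Module.Finite A M]
    (L : List A), L.length = n → Ideal.ofList L = maximalIdeal A → IsWeaklyRegular M L →
      Module.Free A M := by
  induction n with
  | zero =>
    intro A _ _ _ M _ _ _ L hn hm _
    rw [List.length_eq_zero_iff.1 hn, Ideal.ofList_nil] at hm
    let := ((isField_iff_maximalIdeal_eq (R := A)).2 hm.symm).toField
    exact Module.Free.of_divisionRing A M
  | succ n ih =>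
    intro A _ _ _ M _ _ _ L hn hm hL
    obtain ⟨x, L, rfl⟩ := List.exists_cons_of_length_eq_add_one hn
    have hx : x ∈ maximalIdeal A := hm ▸ Ideal.subset_span (by simp)
    have hnt : Nontrivial (A ⧸ Ideal.span {x}) := Ideal.Quotient.nontrivial_iff.2
      (Ideal.span_singleton_ne_top hx)
    rw [isWeaklyRegular_cons_iff'] at hL
    have := Module.finitePresentation_of_finite A M
    rw [← Module.free_quotSMulTop_iff_free (R := A) (M := M) (x := x)
      (maximalIdeal_le_jacobson _ hx) hL.1]
    have : Module.Finite (A ⧸ Ideal.span {x}) (QuotSMulTop x M) :=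
      Module.Finite.of_restrictScalars_finite A _ _
    refine ih (A ⧸ Ideal.span {x}) (QuotSMulTop x M) _ (by simpa using hn) ?_ hL.2
    rw [← Ideal.map_ofList, ← map_mk_maximalIdeal, ← hm, Ideal.ofList_cons, Ideal.map_sup,
      Ideal.map_quotient_self, bot_sup_eq]

end Free

/-! ### The free rank of a module as a length. -/

section FreeRank

universe u v

/-- The elements of `M` sent into the maximal ideal by every linear functional. -/
def nonsplittingSubmodule (A : Type u) [CommRing A] [IsLocalRing A] (M : Type v) [AddCommGroup M]
    [Module A M] : Submodule A M where
  carrier := {x | ∀ φ : M →ₗ[A] A, φ x ∈ maximalIdeal A}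
  add_mem' hx hy φ := by rw [map_add]; exact Ideal.add_mem _ (hx φ) (hy φ)
  zero_mem' φ := by simp
  smul_mem' a x hx φ := by rw [map_smul]; exact Ideal.mul_mem_left _ _ (hx φ)

theorem mem_nonsplittingSubmodule {A : Type u} [CommRing A] [IsLocalRing A] {M : Type v}
    [AddCommGroup M] [Module A M] {x : M} :
    x ∈ nonsplittingSubmodule A M ↔ ∀ φ : M →ₗ[A] A, φ x ∈ maximalIdeal A := Iff.rfl

/-- The numbers of copies of `A` that split off `M`. -/
def freeSummandRanks (A : Type u) [CommRing A] (M : Type v) [AddCommGroup M] [Module A M] : Set ℕ :=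
  {a : ℕ | ∃ (N : Type v) (_ : AddCommGroup N) (_ : Module A N),
    Nonempty (M ≃ₗ[A] (Fin a → A) × N)}

variable {A : Type u} [CommRing A] {M : Type v} [AddCommGroup M] [Module A M]

theorem bddAbove_freeSummandRanks [Nontrivial A] [Module.Finite A M] :
    BddAbove (freeSummandRanks A M) := by
  obtain ⟨n, f, hf⟩ := Module.Finite.exists_fin' A M
  refine ⟨n, ?_⟩
  rintro a ⟨N, _, _, ⟨e⟩⟩
  simpa using card_le_of_surjective A ((LinearMap.fst A (Fin a → A) N ∘ₗ e.toLinearMap) ∘ₗ f)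
    (((LinearMap.fst_surjective (R := A) (M := Fin a → A) (M₂ := N)).comp e.surjective).comp hf)

theorem zero_mem_freeSummandRanks : 0 ∈ freeSummandRanks A M :=
  ⟨M, inferInstance, inferInstance, ⟨{
    toFun := fun x => (0, x)
    invFun := fun x => x.2
    map_add' := fun x y => by simp
    map_smul' := fun a x => by simp
    left_inv := fun x => rfl
    right_inv := fun x => Prod.ext (Subsingleton.elim _ _) rfl }⟩⟩

/-- A functional taking the value `1` splits off a copy of `A`. -/
def LinearMap.splitOff (φ : M →ₗ[A] A) (x : M) (hx : φ x = 1) : M ≃ₗ[A] A × LinearMap.ker φ where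
  toFun y := (φ y, ⟨y - φ y • x, by simp [hx]⟩)
  invFun z := z.1 • x + z.2
  map_add' y z := by ext <;> simp [add_smul]; abel
  map_smul' a y := by ext <;> simp [smul_sub, mul_smul]
  left_inv y := by simp
  right_inv z := by
    have : φ z.2 = 0 := z.2.2
    ext <;> simp [hx, this]

theorem succ_mem_freeSummandRanks {a : ℕ} {N : Type v} [AddCommGroup N] [Module A N]
    (e : M ≃ₗ[A] (Fin a → A) × N) {φ : N →ₗ[A] A} {x : N} (hx : IsUnit (φ x)) :
    a + 1 ∈ freeSummandRanks A M := by
  obtain ⟨c, hc⟩ := hx.exists_left_inv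
  refine ⟨LinearMap.ker φ, inferInstance, inferInstance, ⟨e ≪≫ₗ
    (LinearEquiv.prodCongr (LinearEquiv.refl A _) (φ.splitOff (c • x) (by simpa using hc))) ≪≫ₗ
    (LinearEquiv.prodAssoc A _ _ _).symm ≪≫ₗ
    LinearEquiv.prodCongr (LinearEquiv.prodComm A _ _ ≪≫ₗ
      Fin.consLinearEquiv A (fun _ : Fin (a + 1) => A)) (LinearEquiv.refl A _)⟩⟩

/-- The free rank of a finite module over a local ring as a length. -/
theorem length_quotient_nonsplittingSubmodule [IsLocalRing A] [Module.Finite A M] :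
    Module.length A (M ⧸ nonsplittingSubmodule A M) = (sSup (freeSummandRanks A M) : ℕ) := by
  obtain ⟨N, _, _, ⟨e⟩⟩ := Nat.sSup_mem ⟨0, zero_mem_freeSummandRanks⟩
    (bddAbove_freeSummandRanks (A := A) (M := M))
  -- By maximality of the rank, no functional on the complement `N` takes a unit value: it would
  -- split off one more copy of `A`.
  have hN : ∀ (φ : N →ₗ[A] A) x, φ x ∈ maximalIdeal A := by
    intro φ x
    by_contra hx
    have := le_csSup bddAbove_freeSummandRanks
      (succ_mem_freeSummandRanks e (notMem_maximalIdeal.1 hx))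
    omega
  generalize sSup (freeSummandRanks A M) = a at e
  let f : M →ₗ[A] (Fin a → A ⧸ maximalIdeal A) :=
    (LinearMap.pi fun i => (maximalIdeal A).mkQ ∘ₗ LinearMap.proj i) ∘ₗ
      LinearMap.fst A (Fin a → A) N ∘ₗ e.toLinearMap
  have hf : Function.Surjective f := by
    intro y
    choose z hz using fun i => Ideal.Quotient.mk_surjective (y i)
    refine ⟨e.symm (z, 0), funext fun i => ?_⟩
    simpa [f] using hz i
  have hker : LinearMap.ker f = nonsplittingSubmodule A M := by
    ext x
    have h1 : x ∈ LinearMap.ker f ↔ ∀ i, (e x).1 i ∈ maximalIdeal A := by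
      simp [f, funext_iff, Ideal.Quotient.eq_zero_iff_mem]
    rw [h1, mem_nonsplittingSubmodule]
    refine ⟨fun h φ => ?_, fun h i => h (LinearMap.proj i ∘ₗ
      LinearMap.fst A (Fin a → A) N ∘ₗ e.toLinearMap)⟩
    have h2 : φ x = (φ ∘ₗ e.symm.toLinearMap ∘ₗ LinearMap.inl A _ _) (e x).1 +
        (φ ∘ₗ e.symm.toLinearMap ∘ₗ LinearMap.inr A _ _) (e x).2 := by
      rw [← LinearMap.coprod_apply]
      simp only [LinearMap.coprod_apply, LinearMap.comp_apply, LinearMap.inl_apply,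
        LinearMap.inr_apply, ← map_add]
      simp
    rw [h2, LinearMap.pi_apply_eq_sum_univ]
    refine Ideal.add_mem _ (Ideal.sum_mem _ fun i _ => ?_) (hN _ _)
    exact Ideal.mul_mem_right _ _ (h i)
  rw [← hker, (f.quotKerEquivOfSurjective hf).length_eq, Module.length_pi_of_fintype]
  have : IsSimpleModule A (A ⧸ maximalIdeal A) :=
    isSimpleModule_iff_isCoatom.2 (maximalIdeal.isMaximal A).out
  simp

end FreeRank

/-! ### The nonsplitting ideal of an algebra. -/

section SplittingIdeal

/-- The nonsplitting submodule of an `A`-algebra `B`, as an ideal of `B`. -/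
def splittingIdeal (A : Type*) [CommRing A] [IsLocalRing A] (B : Type*) [CommRing B]
    [Algebra A B] : Ideal B where
  __ := nonsplittingSubmodule A B
  smul_mem' b _ hx φ := hx (φ ∘ₗ LinearMap.mulLeft A b)

theorem mem_splittingIdeal {A : Type*} [CommRing A] [IsLocalRing A] {B : Type*} [CommRing B]
    [Algebra A B] {x : B} :
    x ∈ splittingIdeal A B ↔ ∀ φ : B →ₗ[A] A, φ x ∈ maximalIdeal A := Iff.rfl

theorem length_quotient_splittingIdeal (A : Type*) [CommRing A] [IsLocalRing A] (B : Type*)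
    [CommRing B] [Algebra A B] [Module.Finite A B] :
    Module.length A (B ⧸ splittingIdeal A B) = (sSup (freeSummandRanks A B) : ℕ) := by
  rw [← length_quotient_nonsplittingSubmodule]
  exact (Submodule.Quotient.restrictScalarsEquiv A (splittingIdeal A B)).symm.length_eq

end SplittingIdeal

/-! ### Functionals on a finite free algebra and a generator of the dual. -/

section FreeAlgebra

variable {S B ι : Type*} [CommRing S] [CommRing B] [Algebra S B]

theorem LinearMap.apply_mem_of_mem_map_algebraMap (ψ : B →ₗ[S] S) {I : Ideal S} {y : B}
    (hy : y ∈ I.map (algebraMap S B)) : ψ y ∈ I := by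
  have h : y ∈ I • (⊤ : Submodule S B) := by rw [Ideal.smul_top_eq_map]; exact hy
  refine Submodule.smul_induction_on h (fun r hr n _ => ?_) fun x y hx hy => ?_
  · rw [map_smul]; exact I.mul_mem_right _ hr
  · rw [map_add]; exact I.add_mem hx hy

theorem Module.Basis.mem_map_algebraMap_iff [Fintype ι] (b : Basis ι S B) {I : Ideal S} {y : B} :
    y ∈ I.map (algebraMap S B) ↔ ∀ i, b.repr y i ∈ I := by
  refine ⟨fun hy i => LinearMap.apply_mem_of_mem_map_algebraMap (b.coord i) hy, fun h => ?_⟩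
  rw [← b.sum_repr y]
  refine Ideal.sum_mem _ fun i _ => ?_
  rw [Algebra.smul_def]
  exact Ideal.mul_mem_right _ _ (Ideal.mem_map_of_mem _ (h i))

theorem Module.Basis.exists_coord_notMem [IsLocalRing S] [Fintype ι] (b : Module.Basis ι S B)
    {y : B}
    (hy : y ∉ (maximalIdeal S).map (algebraMap S B)) : ∃ T : B →ₗ[S] S, T y ∉ maximalIdeal S := by
  rw [b.mem_map_algebraMap_iff] at hy
  push Not at hy
  obtain ⟨i, hi⟩ := hy
  exact ⟨b.coord i, hi⟩

/-- Invertibility of the Gram matrix means that `T` generates `Hom_S(B, S)` over `B`: the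
coordinates of `c` solve a linear system with that matrix. -/
theorem exists_eq_comp_mul_of_isUnit_det [Fintype ι] [DecidableEq ι]
    (b : Module.Basis ι S B) {T : B →ₗ[S] S}
    (hdet : IsUnit (Matrix.of fun i j => T (b i * b j)).det) (ψ : B →ₗ[S] S) :
    ∃ c : B, ∀ y, ψ y = T (c * y) := by
  set A : Matrix ι ι S := Matrix.of fun i j => T (b i * b j) with hA
  set v := A⁻¹.mulVec fun i => ψ (b i) with hv
  have hAv : A.mulVec v = fun i => ψ (b i) := by
    rw [hv, Matrix.mulVec_mulVec, Matrix.mul_nonsing_inv _ hdet, Matrix.one_mulVec]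
  refine ⟨∑ i, v i • b i, fun y => ?_⟩
  suffices ψ = T ∘ₗ LinearMap.mulLeft S (∑ i, v i • b i) from congrArg (· y) this
  refine b.ext fun i => ?_
  rw [← congrFun hAv i, LinearMap.comp_apply, LinearMap.mulLeft_apply, Finset.sum_mul, map_sum,
    Matrix.mulVec, dotProduct]
  refine Finset.sum_congr rfl fun j _ => ?_
  rw [smul_mul_assoc, map_smul, smul_eq_mul, mul_comm, mul_comm (b j)]
  simp [hA]

/-- If `u` is essential modulo `𝔫B`, then the matrix of the form `(x, y) ↦ T (x y)` attached to a
functional `T` with `T u` a unit is invertible. -/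
theorem isUnit_det_of_isEssentialElement [IsLocalRing S] [Fintype ι] [DecidableEq ι]
    (b : Module.Basis ι S B) {u : B}
    (hu : ((maximalIdeal S).map (algebraMap S B)).IsEssentialElement u) {T : B →ₗ[S] S}
    (hT : T u ∉ maximalIdeal S) : IsUnit (Matrix.of fun i j => T (b i * b j)).det := by
  by_contra hdet
  set A : Matrix ι ι S := Matrix.of fun i j => T (b i * b j) with hA
  have h0 : ((residue S).mapMatrix A).det = 0 := by
    rw [← RingHom.map_det, residue_eq_zero_iff]
    exact (mem_maximalIdeal _).2 hdet
  -- A null vector over the residue field lifts to `c ∉ 𝔫B` with `T (B c) ⊆ 𝔫`. Since `u ∈ 𝔫B + B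
  -- c`, this forces `T u ∈ 𝔫`.
  obtain ⟨v, hv0, hv⟩ := Matrix.exists_mulVec_eq_zero_iff.2 h0
  choose w hw using fun i => residue_surjective (v i)
  set c : B := ∑ i, w i • b i with hc
  have hrepr : ∀ i, b.repr c i = w i := fun i => by rw [hc, b.repr_sum_self]
  have hcn : c ∉ (maximalIdeal S).map (algebraMap S B) := by
    rw [b.mem_map_algebraMap_iff]
    intro h
    refine hv0 (funext fun i => ?_)
    rw [← hw, ← hrepr, Pi.zero_apply, residue_eq_zero_iff]
    exact h i
  have hTb : ∀ i, T (b i * c) ∈ maximalIdeal S := by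
    intro i
    have := congrFun hv i
    rw [← residue_eq_zero_iff, hc, Finset.mul_sum, map_sum, map_sum]
    rw [Pi.zero_apply, Matrix.mulVec, dotProduct] at this
    rw [← this]
    refine Finset.sum_congr rfl fun j _ => ?_
    rw [mul_smul_comm, map_smul, smul_eq_mul, map_mul, hw, mul_comm]
    simp [hA]
  have hTc : ∀ y : B, T (y * c) ∈ maximalIdeal S := by
    intro y
    rw [← b.sum_repr y, Finset.sum_mul, map_sum]
    refine Ideal.sum_mem _ fun i _ => ?_
    rw [smul_mul_assoc, map_smul]
    exact Ideal.mul_mem_left _ _ (hTb i)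
  have := hu.2 c hcn
  rw [sup_comm, Ideal.mem_span_singleton_sup] at this
  obtain ⟨a, n, hn, rfl⟩ := this
  rw [map_add] at hT
  exact hT (Ideal.add_mem _ (hTc a) (LinearMap.apply_mem_of_mem_map_algebraMap T hn))

end FreeAlgebra

/-! ### Fedder's criterion for a quotient of a free algebra. -/

section Fedder

variable {S B R B' : Type*} [CommRing S] [IsLocalRing S] [CommRing B] [Algebra S B]
  [CommRing R] [IsLocalRing R] [CommRing B'] [Algebra R B']

/-- Fedder's description of the functionals on a quotient. -/
theorem comap_splittingIdeal [Module.Free S B] [Module.Finite S B] {u : B}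
    (hu : ((maximalIdeal S).map (algebraMap S B)).IsEssentialElement u)
    (ρ : S →+* R) (hρ : Function.Surjective ρ) (π : B →+* B') (hπ : Function.Surjective π)
    (hcomm : ∀ s, π (algebraMap S B s) = algebraMap R B' (ρ s)) :
    (splittingIdeal R B').comap π = ((maximalIdeal S).map (algebraMap S B)).colon
      (((RingHom.ker ρ).map (algebraMap S B)).colon (RingHom.ker π : Set B) : Set B) := by
  classical
  let b := Module.Free.chooseBasis S B
  have hloc : IsLocalHom ρ := by
    refine .of_surjective ρ hρ
  have hmem : ∀ s, ρ s ∈ maximalIdeal R ↔ s ∈ maximalIdeal S := fun s => by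
    rw [mem_maximalIdeal, mem_maximalIdeal, mem_nonunits_iff, mem_nonunits_iff, isUnit_map_iff]
  have hsmul : ∀ s x, π (s • x) = ρ s • π x := fun s x => by
    rw [Algebra.smul_def, map_mul, hcomm, Algebra.smul_def]
  obtain ⟨T, hT⟩ := b.exists_coord_notMem hu.1
  have hdet := isUnit_det_of_isEssentialElement b hu hT
  ext x
  rw [Ideal.mem_comap, mem_splittingIdeal, Submodule.mem_colon]
  refine ⟨fun h c hc => ?_, fun h φ => ?_⟩
  -- If `c x ∉ 𝔫B`, some coordinate `ψ` has `ψ (c x)` a unit. The colon condition on `c` makes `ψ (c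
  -- ·)` descend to a functional `φ` on `B'`, which then takes a unit value at `π x`.
  · by_contra hcx
    rw [smul_eq_mul] at hcx
    obtain ⟨ψ, hψ⟩ := b.exists_coord_notMem hcx
    have hker : ∀ y ∈ RingHom.ker π, ρ (ψ (c * y)) = 0 := fun y hy =>
      (RingHom.mem_ker).1 (LinearMap.apply_mem_of_mem_map_algebraMap ψ
        (Submodule.mem_colon.1 hc y hy))
    choose σ hσ using hπ
    have hσ' : ∀ y, ρ (ψ (c * σ (π y))) = ρ (ψ (c * y)) := fun y => by
      rw [← sub_eq_zero, ← map_sub, ← map_sub, ← mul_sub]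
      exact hker _ (by rw [RingHom.mem_ker, map_sub, hσ, sub_self])
    let φ : B' →ₗ[R] R :=
      { toFun := fun y => ρ (ψ (c * σ y))
        map_add' := fun y z => by
          have := hσ' (σ y + σ z)
          rw [map_add, hσ, hσ] at this
          rw [this, mul_add, map_add, map_add]
        map_smul' := fun r y => by
          obtain ⟨s, rfl⟩ := hρ r
          have := hσ' (s • σ y)
          rw [hsmul, hσ] at this
          rw [this, mul_smul_comm, map_smul, smul_eq_mul, map_mul, RingHom.id_apply, smul_eq_mul] }
    have h1 := h φ
    change ρ (ψ (c * σ (π x))) ∈ maximalIdeal R at h1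
    rw [hσ', hmem, mul_comm] at h1
    exact hψ h1
  · choose σ hσ using hρ
    -- Freeness of `B` allows `φ` to be lifted to `ψ`, which is `T (c ·)` for some `c`.
    let ψ : B →ₗ[S] S := b.constr S fun i => σ (φ (π (b i)))
    have hψ : ∀ y, ρ (ψ y) = φ (π y) := by
      intro y
      rw [← b.sum_repr y]
      simp only [map_sum, hsmul, map_smul, smul_eq_mul, map_mul]
      refine Finset.sum_congr rfl fun i _ => ?_
      rw [b.constr_basis, hσ]
    obtain ⟨c, hc⟩ := exists_eq_comp_mul_of_isUnit_det b hdet ψ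
    have hcJ : c ∈ ((RingHom.ker ρ).map (algebraMap S B)).colon (RingHom.ker π : Set B) := by
      refine Submodule.mem_colon.2 fun y hy => ?_
      rw [b.mem_map_algebraMap_iff]
      intro i
      -- The `i`-th coordinate of `c y` is `T (d c y) = ψ (d y)`, which reduces to `φ (π (d y)) =
      -- 0`.
      obtain ⟨d, hd⟩ := exists_eq_comp_mul_of_isUnit_det b hdet (b.coord i)
      rw [← b.coord_apply, hd, RingHom.mem_ker, smul_eq_mul, mul_left_comm, ← hc, hψ,
        (RingHom.mem_ker).1 (Ideal.mul_mem_left _ d hy), map_zero]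
    rw [← hψ, hmem, hc, mul_comm]
    exact LinearMap.apply_mem_of_mem_map_algebraMap T (h c hcJ)

end Fedder

/-! ### Duality of lengths in the closed fibre. -/

section Duality

variable {S B ι : Type*} [CommRing S] [IsLocalRing S] [CommRing B] [Algebra S B]

/-- The reduction of an ideal of a free algebra modulo the maximal ideal, in coordinates. -/
def Module.Basis.reduction (b : Module.Basis ι S B) (N : Ideal B) :
    Submodule (ResidueField S) (ι → ResidueField S) where
  carrier := {v | ∃ y ∈ N, ∀ i, v i = residue S (b.repr y i)}
  add_mem' := by
    rintro v w ⟨y, hy, hv⟩ ⟨z, hz, hw⟩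
    exact ⟨y + z, N.add_mem hy hz, fun i => by simp [hv, hw]⟩
  zero_mem' := ⟨0, N.zero_mem, fun i => by simp⟩
  smul_mem' := by
    rintro a v ⟨y, hy, hv⟩
    obtain ⟨s, rfl⟩ := residue_surjective a
    refine ⟨s • y, ?_, fun i => by simp [hv]⟩
    rw [Algebra.smul_def]
    exact N.mul_mem_left _ hy

variable [Fintype ι]

theorem Module.Basis.mem_reduction_iff (b : Module.Basis ι S B) {N : Ideal B}
    (hN : (maximalIdeal S).map (algebraMap S B) ≤ N) {y : B} :
    (fun i => residue S (b.repr y i)) ∈ b.reduction N ↔ y ∈ N := by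
  refine ⟨?_, fun hy => ⟨y, hy, fun _ => rfl⟩⟩
  rintro ⟨z, hz, h⟩
  have : y - z ∈ (maximalIdeal S).map (algebraMap S B) := by
    rw [b.mem_map_algebraMap_iff]
    intro i
    rw [← residue_eq_zero_iff, map_sub, Finsupp.sub_apply, map_sub, sub_eq_zero]
    exact h i
  simpa using N.add_mem (hN this) hz

theorem Module.Basis.length_quotient_eq (b : Module.Basis ι S B) {N : Ideal B}
    (hN : (maximalIdeal S).map (algebraMap S B) ≤ N) :
    Module.length S (B ⧸ N) =
      (Fintype.card ι - Module.finrank (ResidueField S) (b.reduction N) : ℕ) := by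
  let r : B →ₗ[S] (ι → ResidueField S) :=
    LinearMap.pi fun i => (Algebra.linearMap S (ResidueField S)) ∘ₗ b.coord i
  have hr : ∀ y, r y = fun i => residue S (b.repr y i) := fun y => rfl
  have hrs : Function.Surjective r := by
    intro v
    choose w hw using fun i => residue_surjective (v i)
    refine ⟨∑ i, w i • b i, ?_⟩
    rw [hr]
    exact funext fun i => by rw [b.repr_sum_self, hw]
  let f : B →ₗ[S] ((ι → ResidueField S) ⧸ b.reduction N) :=
    ((b.reduction N).mkQ.restrictScalars S) ∘ₗ r
  have hf : Function.Surjective f := (Submodule.mkQ_surjective _).comp hrs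
  have hker : LinearMap.ker f = N.restrictScalars S := by
    ext y
    rw [LinearMap.mem_ker, Submodule.restrictScalars_mem, ← b.mem_reduction_iff hN, ← hr]
    exact Submodule.Quotient.mk_eq_zero _
  rw [← (Submodule.Quotient.restrictScalarsEquiv S N).length_eq, ← hker,
    (f.quotKerEquivOfSurjective hf).length_eq,
    Module.length_eq_of_surjective (R := ResidueField S) residue_surjective,
    Module.length_eq_finrank, Submodule.finrank_quotient]
  simp

/-- Gorenstein duality for the closed fibre of a free algebra. -/
theorem length_quotient_colon_add [Module.Free S B] [Module.Finite S B] {u : B}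
    (hu : ((maximalIdeal S).map (algebraMap S B)).IsEssentialElement u) (C : Ideal B) :
    Module.length S (B ⧸ ((maximalIdeal S).map (algebraMap S B)).colon (C : Set B)) +
      Module.length S (B ⧸ C ⊔ (maximalIdeal S).map (algebraMap S B)) =
      Module.length S (B ⧸ (maximalIdeal S).map (algebraMap S B)) := by
  classical
  let b := Module.Free.chooseBasis S B
  obtain ⟨T, hT⟩ := b.exists_coord_notMem hu.1
  have hdet := isUnit_det_of_isEssentialElement b hu hT
  set 𝔮 := (maximalIdeal S).map (algebraMap S B) with h𝔮
  set A := Matrix.of fun i j => T (b i * b j) with hA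
  let β := Matrix.toBilin' ((residue S).mapMatrix A)
  have hβ : β.Nondegenerate := by
    rw [LinearMap.BilinForm.nondegenerate_toBilin'_iff_det_ne_zero, ← RingHom.map_det, Ne,
      residue_eq_zero_iff]
    exact notMem_maximalIdeal.2 hdet
  have hβT : ∀ y z : B, β (fun i => residue S (b.repr y i)) (fun i => residue S (b.repr z i)) =
      residue S (T (y * z)) := by
    intro y z
    conv_rhs => rw [← b.sum_repr y, ← b.sum_repr z]
    simp only [β, Matrix.toBilin'_apply, Finset.sum_mul, Finset.mul_sum, map_sum, smul_mul_assoc,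
      mul_smul_comm, map_smul, smul_eq_mul, map_mul]
    rw [Finset.sum_comm]
    refine Finset.sum_congr rfl fun j _ => Finset.sum_congr rfl fun i _ => ?_
    simp only [hA, RingHom.mapMatrix_apply, Matrix.map_apply, Matrix.of_apply]
    ring
  have hle : 𝔮 ≤ 𝔮.colon (C : Set B) := fun y hy => Submodule.mem_colon.2 fun c _ =>
    Ideal.mul_mem_right _ _ hy
  have hTq : ∀ y, (∀ c, T (c * y) ∈ maximalIdeal S) → y ∈ 𝔮 := by
    intro y h
    rw [h𝔮, b.mem_map_algebraMap_iff]
    intro i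
    obtain ⟨d, hd⟩ := exists_eq_comp_mul_of_isUnit_det b hdet (b.coord i)
    rw [← b.coord_apply, hd]
    exact h d
  -- Under the perfect pairing induced by `T` on `B / 𝔫B`, the annihilator of `C` is its orthogonal
  -- complement; the length formula is then a dimension count.
  have horth : β.orthogonal (b.reduction (C ⊔ 𝔮)) = b.reduction (𝔮.colon (C : Set B)) := by
    ext v
    choose w hw using fun i => residue_surjective (v i)
    have hv : v = fun i => residue S (b.repr (∑ j, w j • b j) i) :=
      funext fun i => by rw [b.repr_sum_self, hw]
    generalize ∑ j, w j • b j = y at hv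
    subst hv
    rw [b.mem_reduction_iff hle, LinearMap.BilinForm.mem_orthogonal_iff, Submodule.mem_colon]
    constructor
    · intro h c hc
      refine hTq _ fun d => ?_
      have := h _ ((b.mem_reduction_iff le_sup_right).2
        (Ideal.mem_sup_left (C.mul_mem_left d hc)))
      rw [hβT, residue_eq_zero_iff] at this
      convert this using 2
      rw [smul_eq_mul]; ring
    · rintro h _ ⟨c, hc, hc'⟩
      obtain rfl := funext hc'
      change β (fun i => residue S (b.repr c i)) (fun i => residue S (b.repr y i)) = 0
      rw [hβT, residue_eq_zero_iff]
      refine LinearMap.apply_mem_of_mem_map_algebraMap T ?_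
      obtain ⟨c', hc₁, n, hn, rfl⟩ := Submodule.mem_sup.1 hc
      rw [add_mul, mul_comm c']
      exact Ideal.add_mem _ (h c' hc₁) (Ideal.mul_mem_right _ _ hn)
  have hq0 : b.reduction 𝔮 = ⊥ := by
    rw [eq_bot_iff]
    rintro v ⟨y, hy, hv⟩
    refine funext fun i => ?_
    rw [hv, Pi.zero_apply, residue_eq_zero_iff]
    exact b.mem_map_algebraMap_iff.1 hy i
  rw [b.length_quotient_eq hle, b.length_quotient_eq le_sup_right, b.length_quotient_eq le_rfl,
    ← horth, LinearMap.BilinForm.finrank_orthogonal hβ, hq0, finrank_bot]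
  have := (b.reduction (C ⊔ 𝔮)).finrank_le
  rw [Module.finrank_fintype_fun_eq_card] at this ⊢
  exact_mod_cast (by omega : ∀ m n : ℕ, m ≤ n → n - (n - m) + (n - m) = n - 0) _ _ this

end Duality

/-- `F^e_* R` as an `R`-algebra: the ring `R`, regarded as an algebra over itself through the `e`-th
iterate of Frobenius. -/
def FrobeniusAlgebra (_p _e : ℕ) (R : Type*) : Type _ := R

/-! ### The Frobenius pushforward as an algebra. -/

namespace FrobeniusAlgebra

variable (p e : ℕ) (R : Type*) [CommRing R]

instance : CommRing (FrobeniusAlgebra p e R) := inferInstanceAs (CommRing R)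

/-- `F^e_* R` as a ring is `R`. -/
def ringEquiv : R ≃+* FrobeniusAlgebra p e R := RingEquiv.refl R

variable [ExpChar R p]

instance : Algebra R (FrobeniusAlgebra p e R) where
  smul r x := ringEquiv p e R (r ^ p ^ e) * x
  algebraMap := (ringEquiv p e R).toRingHom.comp (iterateFrobenius R p e)
  commutes' _ _ := mul_comm _ _
  smul_def' _ _ := rfl

theorem algebraMap_eq :
    algebraMap R (FrobeniusAlgebra p e R) =
      (ringEquiv p e R).toRingHom.comp (iterateFrobenius R p e) := rfl

theorem algebraMap_apply (x : R) :
    algebraMap R (FrobeniusAlgebra p e R) x = ringEquiv p e R (x ^ p ^ e) := rfl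

theorem smul_ringEquiv (r x : R) : r • ringEquiv p e R x = ringEquiv p e R (r ^ p ^ e * x) := rfl

/-- The identification of the `R`-module `F^e_* R` with the `R`-algebra `F^e_* R`. -/
def linearEquiv : FrobeniusPushforward p e R ≃ₗ[R] FrobeniusAlgebra p e R where
  __ := (FrobeniusPushforward.of p e R).symm.trans (ringEquiv p e R).toAddEquiv
  map_smul' _ _ := rfl

instance [IsLocalRing R] : IsLocalRing (FrobeniusAlgebra p e R) :=
  (ringEquiv p e R).isLocalRing

instance [IsNoetherianRing R] : IsNoetherianRing (FrobeniusAlgebra p e R) :=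
  isNoetherianRing_of_ringEquiv R (ringEquiv p e R)

instance [Fact p.Prime] : IsLocalHom (algebraMap R (FrobeniusAlgebra p e R)) where
  map_nonunit x hx := by
    rw [algebraMap_apply, isUnit_map_iff] at hx
    exact (isUnit_pow_iff (pow_ne_zero _ (Fact.out : p.Prime).ne_zero)).1 hx

/-- `F^{e+1}_* R` as an algebra over `F^e_* R`, through the Frobenius. -/
abbrev algebraSucc : Algebra (FrobeniusAlgebra p e R) (FrobeniusAlgebra p (e + 1) R) :=
  (((ringEquiv p (e + 1) R).toRingHom.comp (frobenius R p)).comp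
    (ringEquiv p e R).symm.toRingHom).toAlgebra

attribute [local instance] algebraSucc in
theorem isScalarTower_succ :
    IsScalarTower R (FrobeniusAlgebra p e R) (FrobeniusAlgebra p (e + 1) R) :=
  .of_algebraMap_eq fun x => by
    change ringEquiv p (e + 1) R (x ^ p ^ (e + 1)) = ringEquiv p (e + 1) R ((x ^ p ^ e) ^ p)
    rw [← pow_mul, pow_succ]

attribute [local instance] algebraSucc in
-- Each step `F^e_* R → F^{e+1}_* R` is a copy of `R → F_* R`, and finiteness is transitive.
theorem finite_of_isFFinite (h : IsFFinite p R) : Module.Finite R (FrobeniusAlgebra p e R) := by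
  induction e with
  | zero =>
    refine Module.Finite.of_surjective (Algebra.linearMap R (FrobeniusAlgebra p 0 R)) fun x => ?_
    refine ⟨(ringEquiv p 0 R).symm x, ?_⟩
    rw [Algebra.linearMap_apply, algebraMap_apply]
    simp
  | succ e ih =>
    have : Module.Finite R (FrobeniusPushforward p 1 R) := h
    have := Module.Finite.equiv (linearEquiv p 1 R)
    have := isScalarTower_succ p e R
    have : Module.Finite (FrobeniusAlgebra p e R) (FrobeniusAlgebra p (e + 1) R) :=
      Module.Finite.of_equiv_equiv (ringEquiv p e R)
        ((ringEquiv p 1 R).symm.trans (ringEquiv p (e + 1) R)) (by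
        ext x
        change ringEquiv p (e + 1) R (x ^ p) = ringEquiv p (e + 1) R (x ^ p ^ 1)
        rw [pow_one])
    exact Module.Finite.trans (FrobeniusAlgebra p e R) _

end FrobeniusAlgebra

/-! ### Residue degrees and change of length along Frobenius. -/

section ResidueDegree

open FrobeniusAlgebra

variable (p e : ℕ) [Fact p.Prime]

instance (k : Type*) [Field k] : Field (FrobeniusAlgebra p e k) := inferInstanceAs (Field k)

attribute [local instance] algebraSucc in
theorem finrank_frobeniusAlgebra_field (k : Type*) [Field k] [CharP k p] :
    Module.finrank k (FrobeniusAlgebra p e k) =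
      Module.finrank (frobenius k p).fieldRange k ^ e := by
  have h1 : Module.finrank k (FrobeniusAlgebra p 1 k) =
      Module.finrank (frobenius k p).fieldRange k :=
    Algebra.finrank_eq_of_equiv_equiv (RingEquiv.ofBijective (frobenius k p).rangeRestrictField
      (frobenius k p).rangeRestrictField_bijective) (ringEquiv p 1 k).symm (by
        ext x
        change x ^ p = x ^ p ^ 1
        rw [pow_one])
  induction e with
  | zero =>
    rw [pow_zero, ← Module.finrank_self k]
    refine (Algebra.finrank_eq_of_equiv_equiv (RingEquiv.refl k) (ringEquiv p 0 k) ?_).symm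
    ext x
    change ringEquiv p 0 k (x ^ p ^ 0) = ringEquiv p 0 k x
    rw [pow_zero, pow_one]
  | succ e ih =>
    have := isScalarTower_succ p e k
    rw [← Module.finrank_mul_finrank k (FrobeniusAlgebra p e k)
      (FrobeniusAlgebra p (e + 1) k), ih, pow_succ, ← h1]
    congr 1
    refine (Algebra.finrank_eq_of_equiv_equiv (ringEquiv p e k)
        ((ringEquiv p 1 k).symm.trans (ringEquiv p (e + 1) k)) ?_).symm
    ext x
    change ringEquiv p (e + 1) k (x ^ p) = ringEquiv p (e + 1) k (x ^ p ^ 1)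
    rw [pow_one]

variable (R : Type*) [CommRing R] [IsLocalRing R] [CharP R p]

/-- The degree `[k : k ^ p]` for the residue field `k`. -/
noncomputable abbrev residueFrobeniusDegree : ℕ :=
  Module.finrank (frobenius (ResidueField R) p).fieldRange (ResidueField R)

theorem finrank_residueField_frobeniusAlgebra :
    Module.finrank (ResidueField R) (ResidueField (FrobeniusAlgebra p e R)) =
      residueFrobeniusDegree p R ^ e := by
  rw [← finrank_frobeniusAlgebra_field]
  refine Algebra.finrank_eq_of_equiv_equiv (RingEquiv.refl _)
    ((ResidueField.mapEquiv (ringEquiv p e R)).symm.trans (ringEquiv p e (ResidueField R))) ?_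
  ext x
  obtain ⟨y, rfl⟩ := residue_surjective x
  simp only [RingHom.comp_apply, RingEquiv.toRingHom_eq_coe, RingHom.coe_coe, RingEquiv.trans_apply,
    RingEquiv.refl_apply, ResidueField.algebraMap_residue, FrobeniusAlgebra.algebraMap_apply,
    ResidueField.mapEquiv.symm, ResidueField.mapEquiv_apply, ResidueField.map_residue, map_pow]
  simp

theorem finite_residueField (h : IsFFinite p R) :
    Module.Finite (ResidueField R) (ResidueField (FrobeniusAlgebra p e R)) := by
  have := finite_of_isFFinite p e R h
  infer_instance

theorem residueFrobeniusDegree_pos (h : IsFFinite p R) : 0 < residueFrobeniusDegree p R := by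
  have := finite_residueField p 1 R h
  rw [← pow_one (residueFrobeniusDegree p R), ← finrank_residueField_frobeniusAlgebra]
  exact Module.finrank_pos

/-- A simple module over `F^e_* R` is its residue field, whose `R`-length is its degree over `k`. -/
theorem length_frobeniusAlgebra (h : IsFFinite p R) (M : Type*) [AddCommGroup M] [Module R M]
    [Module (FrobeniusAlgebra p e R) M] [IsScalarTower R (FrobeniusAlgebra p e R) M] :
    Module.length R M =
      Module.length (FrobeniusAlgebra p e R) M * (residueFrobeniusDegree p R ^ e : ℕ) := by
  have := finite_residueField p e R h
  rw [length_restrictScalars R (FrobeniusAlgebra p e R) M, Module.length_eq_finrank,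
    finrank_residueField_frobeniusAlgebra]

end ResidueDegree

/-! ### Transport of ideals along ring isomorphisms. -/

section RingEquiv

variable {A B : Type*} [CommRing A] [CommRing B] (ε : A ≃+* B)

theorem Ideal.length_quotient_map_ringEquiv (I : Ideal A) :
    Module.length B (B ⧸ I.map ε) = Module.length A (A ⧸ I) := by
  rw [Module.length_quotient, Module.length_quotient,
    ← Order.coheight_orderIso ε.idealComapOrderIso]
  congr 1
  exact Ideal.comap_map_of_bijective ε ε.bijective

theorem Ideal.apply_mem_map_ringEquiv {I : Ideal A} {x : A} : ε x ∈ I.map ε ↔ x ∈ I := by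
  rw [← Ideal.mem_comap, Ideal.comap_map_of_bijective ε ε.bijective]

theorem Ideal.map_colon_ringEquiv (I K : Ideal A) :
    (I.colon (K : Set A)).map ε = (I.map ε).colon (K.map ε : Set B) := by
  ext y
  obtain ⟨x, rfl⟩ := ε.surjective y
  rw [apply_mem_map_ringEquiv, Submodule.mem_colon, Submodule.mem_colon]
  constructor
  · intro h z hz
    obtain ⟨z, rfl⟩ := ε.surjective z
    rw [smul_eq_mul, ← map_mul]
    exact (apply_mem_map_ringEquiv ε).2 (h z ((apply_mem_map_ringEquiv ε).1 hz))
  · intro h z hz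
    have := h (ε z) ((apply_mem_map_ringEquiv ε).2 hz)
    rwa [smul_eq_mul, ← map_mul, apply_mem_map_ringEquiv] at this

theorem Ideal.IsEssentialElement.map_ringEquiv {I : Ideal A} {u : A} (h : I.IsEssentialElement u) :
    (I.map ε).IsEssentialElement (ε u) := by
  refine ⟨(apply_mem_map_ringEquiv ε).not.2 h.1, fun s hs => ?_⟩
  obtain ⟨s, rfl⟩ := ε.surjective s
  have := Ideal.mem_map_of_mem ε (h.2 s ((apply_mem_map_ringEquiv ε).not.1 hs))
  rwa [Ideal.map_sup, Ideal.map_span, Set.image_singleton] at this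

end RingEquiv

/-! ### Splitting numbers as lengths. -/

section SplittingNumber

open FrobeniusAlgebra

theorem fSplittingNumber_eq_sSup (p e : ℕ) (R : Type*) [CommRing R] [ExpChar R p] :
    fSplittingNumber p e R = sSup (freeSummandRanks R (FrobeniusAlgebra p e R)) := by
  refine congrArg sSup (Set.ext fun a => ?_)
  exact ⟨fun ⟨N, h1, h2, ⟨f⟩⟩ => ⟨N, h1, h2, ⟨(linearEquiv p e R).symm ≪≫ₗ f⟩⟩,
    fun ⟨N, h1, h2, ⟨f⟩⟩ => ⟨N, h1, h2, ⟨linearEquiv p e R ≪≫ₗ f⟩⟩⟩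

theorem map_algebraMap_frobeniusAlgebra (p e : ℕ) (R : Type*) [CommRing R] [ExpChar R p]
    (I : Ideal R) :
    I.map (algebraMap R (FrobeniusAlgebra p e R)) =
      (frobeniusPower p e I).map (ringEquiv p e R) := by
  rw [algebraMap_eq, ← Ideal.map_map]
  rfl

variable (p e : ℕ) [Fact p.Prime] (R : Type*) [CommRing R] [IsLocalRing R] [CharP R p]

theorem length_quotient_frobeniusAlgebra (h : IsFFinite p R) (I : Ideal R) :
    Module.length R (FrobeniusAlgebra p e R ⧸ I.map (ringEquiv p e R)) =
      Module.length R (R ⧸ I) * (residueFrobeniusDegree p R ^ e : ℕ) := by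
  rw [length_frobeniusAlgebra p e R h, Ideal.length_quotient_map_ringEquiv]

/-- The ideal of the elements `x` for which `F^e_* x` does not generate a free summand. -/
noncomputable def nonsplittingIdeal : Ideal R :=
  (splittingIdeal R (FrobeniusAlgebra p e R)).comap (ringEquiv p e R)

theorem fSplittingNumber_eq_length (h : IsFFinite p R) :
    (fSplittingNumber p e R : ℕ∞) =
      Module.length R (R ⧸ nonsplittingIdeal p e R) * (residueFrobeniusDegree p R ^ e : ℕ) := by
  have := finite_of_isFFinite p e R h
  rw [fSplittingNumber_eq_sSup, ← length_quotient_splittingIdeal,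
    ← length_quotient_frobeniusAlgebra p e R h, nonsplittingIdeal,
    Ideal.map_comap_of_surjective _ (ringEquiv p e R).surjective]

/-- Finiteness comes for free: the length times a positive integer is the natural number `a_e`. -/
theorem length_quotient_nonsplittingIdeal_ne_top (h : IsFFinite p R) :
    Module.length R (R ⧸ nonsplittingIdeal p e R) ≠ ⊤ := by
  intro htop
  have := fSplittingNumber_eq_length p e R h
  rw [htop, ENat.top_mul (by
    exact_mod_cast (pow_pos (residueFrobeniusDegree_pos p R h) e).ne')] at this
  exact ENat.natCast_ne_top _ this

end SplittingNumber

/-! ### Freeness of Frobenius and Fedder's ideal over a regular local ring. -/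

section Regular

open FrobeniusAlgebra RingTheory.Sequence

variable (p e : ℕ) [Fact p.Prime] (S : Type*) [CommRing S] [IsRegularLocalRing S] [CharP S p]

/-- One direction of Kunz's theorem. A regular system of parameters acts on `F^e_* S` as its `p ^
e`-th powers act on `S`, and these still form a regular sequence. -/
theorem free_frobeniusAlgebra (h : IsFFinite p S) : Module.Free S (FrobeniusAlgebra p e S) := by
  have := finite_of_isFFinite p e S h
  obtain ⟨L, hLm, hL⟩ := IsRegularLocalRing.exists_regular_parameters S
  refine Module.free_of_isWeaklyRegular _ S _ L rfl hLm ?_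
  rw [← isWeaklyRegular_map_algebraMap_iff (R := S) (FrobeniusAlgebra p e S)]
  have h1 := (hL (p ^ e) (pow_ne_zero _ (Fact.out : p.Prime).ne_zero)).1
  refine (AddEquiv.isWeaklyRegular_congr (e := (ringEquiv p e S).toAddEquiv) ?_).1 h1
  rw [List.forall₂_map_left_iff, List.forall₂_map_right_iff, List.forall₂_same]
  intro x _ y
  exact map_mul (ringEquiv p e S) _ _

theorem exists_isEssentialElement_frobeniusAlgebra : ∃ u,
    ((maximalIdeal S).map (algebraMap S (FrobeniusAlgebra p e S))).IsEssentialElement u := by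
  obtain ⟨L, hLm, hL⟩ := IsRegularLocalRing.exists_regular_parameters S
  obtain ⟨u, hu⟩ := (hL (p ^ e) (pow_ne_zero _ (Fact.out : p.Prime).ne_zero)).2
  refine ⟨ringEquiv p e S u, ?_⟩
  rw [map_algebraMap_frobeniusAlgebra, frobeniusPower, ← hLm, Ideal.map_ofList]
  exact hu.map_ringEquiv _

variable (J : Ideal S)

theorem map_fedderIdeal : (fedderIdeal p e J).map (ringEquiv p e S) =
    ((maximalIdeal S).map (algebraMap S (FrobeniusAlgebra p e S))).colon
      ((frobeniusColon p e J).map (ringEquiv p e S) : Set (FrobeniusAlgebra p e S)) := by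
  rw [fedderIdeal, Ideal.map_colon_ringEquiv, map_algebraMap_frobeniusAlgebra]

/-- Fedder's description applied to `F^e_*` of the quotient map: its kernel is `F^e_* J`, and `J`
extends to `F^e_*(J^[p^e])`. -/
theorem comap_nonsplittingIdeal (h : IsFFinite p S) [Nontrivial (S ⧸ J)] :
    (nonsplittingIdeal p e (S ⧸ J)).comap (Ideal.Quotient.mk J) = fedderIdeal p e J := by
  have := finite_of_isFFinite p e S h
  have := free_frobeniusAlgebra p e S h
  obtain ⟨u, hu⟩ := exists_isEssentialElement_frobeniusAlgebra p e S
  let π : FrobeniusAlgebra p e S →+* FrobeniusAlgebra p e (S ⧸ J) :=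
    ((ringEquiv p e (S ⧸ J)).toRingHom.comp (Ideal.Quotient.mk J)).comp
      (ringEquiv p e S).symm.toRingHom
  have hπ : ∀ x, π (ringEquiv p e S x) = ringEquiv p e (S ⧸ J) (Ideal.Quotient.mk J x) :=
    fun x => rfl
  have hsurj : Function.Surjective π := (ringEquiv p e (S ⧸ J)).surjective.comp
    (Ideal.Quotient.mk_surjective.comp (ringEquiv p e S).symm.surjective)
  have key := comap_splittingIdeal hu (Ideal.Quotient.mk J) Ideal.Quotient.mk_surjective π hsurj
    (fun s => by rw [algebraMap_apply, algebraMap_apply, hπ, map_pow])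
  have hker : RingHom.ker π = J.map (ringEquiv p e S) := by
    ext y
    obtain ⟨x, rfl⟩ := (ringEquiv p e S).surjective y
    rw [Ideal.apply_mem_map_ringEquiv, RingHom.mem_ker, hπ,
      map_eq_zero_iff _ (RingEquiv.injective _),
      Ideal.Quotient.eq_zero_iff_mem]
  rw [hker, Ideal.mk_ker, map_algebraMap_frobeniusAlgebra p e S J, ← Ideal.map_colon_ringEquiv,
    ← frobeniusColon, ← map_fedderIdeal] at key
  ext x
  rw [← Ideal.apply_mem_map_ringEquiv (ringEquiv p e S) (I := fedderIdeal p e J), ← key]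
  rfl

theorem length_quotient_fedderIdeal (h : IsFFinite p S) [Nontrivial (S ⧸ J)] :
    Module.length S (S ⧸ fedderIdeal p e J) =
      Module.length (S ⧸ J) ((S ⧸ J) ⧸ nonsplittingIdeal p e (S ⧸ J)) := by
  rw [← Module.length_eq_of_surjective (S := S) (R := S ⧸ J) Ideal.Quotient.mk_surjective]
  let f : S →ₗ[S] (S ⧸ J) ⧸ nonsplittingIdeal p e (S ⧸ J) :=
    ((nonsplittingIdeal p e (S ⧸ J)).mkQ.restrictScalars S) ∘ₗ J.mkQ
  have hf : Function.Surjective f :=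
    (Submodule.mkQ_surjective _).comp (Submodule.mkQ_surjective _)
  have hker : LinearMap.ker f = fedderIdeal p e J := by
    rw [← comap_nonsplittingIdeal p e S J h]
    ext x
    exact Submodule.Quotient.mk_eq_zero _
  rw [← hker, (f.quotKerEquivOfSurjective hf).length_eq]

/-- With `C = J^[q] : J` and `𝔮 = 𝔫^[q]`, duality and the exact sequence `0 → C / (C ∩ 𝔮) → S / 𝔮 →
S / (C + 𝔮) → 0` both express `ℓ(S / 𝔮)`; the common term `ℓ(S / (C + 𝔮))` cancels because `ℓ(S /
𝔮)` is finite. -/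
theorem length_fedderQuotient (h : IsFFinite p S) :
    Module.length S (S ⧸ fedderIdeal p e J) = Module.length S (FedderQuotient p e J) := by
  have := finite_of_isFFinite p e S h
  have := free_frobeniusAlgebra p e S h
  obtain ⟨u, hu⟩ := exists_isEssentialElement_frobeniusAlgebra p e S
  have key := length_quotient_colon_add hu ((frobeniusColon p e J).map (ringEquiv p e S))
  rw [← map_fedderIdeal, map_algebraMap_frobeniusAlgebra, ← Ideal.map_sup] at key
  simp only [length_quotient_frobeniusAlgebra p e S h] at key
  set C := frobeniusColon p e J
  set 𝔮 := frobeniusPower p e (maximalIdeal S)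
  have hpos : 0 < residueFrobeniusDegree p S ^ e := pow_pos (residueFrobeniusDegree_pos p S h) e
  have hκ : ((residueFrobeniusDegree p S ^ e : ℕ) : ℕ∞) ≠ 0 := by exact_mod_cast hpos.ne'
  have h𝔮 : Module.length S (S ⧸ 𝔮) ≠ ⊤ := by
    have h1 := (Module.Free.chooseBasis S (FrobeniusAlgebra p e S)).length_quotient_eq
      (le_refl ((maximalIdeal S).map (algebraMap S (FrobeniusAlgebra p e S))))
    rw [map_algebraMap_frobeniusAlgebra, length_quotient_frobeniusAlgebra p e S h] at h1
    intro htop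
    rw [htop, ENat.top_mul hκ] at h1
    exact ENat.natCast_ne_top _ h1.symm
  rw [← add_mul] at key
  have key' := (ENat.mul_left_strictMono hκ (ENat.natCast_ne_top _)).injective key
  let f : FedderQuotient p e J →ₗ[S] S ⧸ 𝔮 :=
    Submodule.mapQ _ _ C.subtype (fun x hx => hx.2)
  let g : S ⧸ 𝔮 →ₗ[S] S ⧸ C ⊔ 𝔮 := Submodule.factor le_sup_right
  have hf : Function.Injective f := by
    rw [← LinearMap.ker_eq_bot, eq_bot_iff]
    intro x hx
    obtain ⟨x, rfl⟩ := Submodule.Quotient.mk_surjective _ x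
    have : (x : S) ∈ 𝔮 := (Submodule.Quotient.mk_eq_zero _).1 hx
    exact (Submodule.Quotient.mk_eq_zero _).2 ⟨x.2, this⟩
  have hg : Function.Surjective g := Submodule.factor_surjective _
  have hfg : Function.Exact f g := by
    intro y
    obtain ⟨y, rfl⟩ := Submodule.Quotient.mk_surjective _ y
    constructor
    · intro hy
      obtain ⟨c, hc, n, hn, rfl⟩ := Submodule.mem_sup.1 ((Submodule.Quotient.mk_eq_zero _).1 hy)
      refine ⟨Submodule.Quotient.mk ⟨c, hc⟩, ?_⟩
      refine (Submodule.Quotient.eq _).2 ?_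
      simpa using hn
    · rintro ⟨x, hx⟩
      obtain ⟨x, rfl⟩ := Submodule.Quotient.mk_surjective _ x
      rw [← hx]
      exact (Submodule.Quotient.mk_eq_zero _).2 (Ideal.mem_sup_left x.2)
  rw [Module.length_eq_add_of_exact f g hf hg hfg] at key'
  rw [Module.length_eq_add_of_exact f g hf hg hfg] at h𝔮
  exact ENat.add_left_injective_of_ne_top (fun h => h𝔮 (by rw [h, add_top])) key'

end Regular

/-! ### Elementary bounds on lengths. -/

section LengthBounds

variable {R : Type*} [CommRing R]

theorem Module.length_le_add_of_exact {M N P : Type*} [AddCommGroup M] [Module R M]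
    [AddCommGroup N] [Module R N] [AddCommGroup P] [Module R P] (f : N →ₗ[R] M) (g : M →ₗ[R] P)
    (hg : Function.Surjective g) (H : Function.Exact f g) :
    Module.length R M ≤ Module.length R N + Module.length R P := by
  rw [Module.length_eq_add_of_exact (LinearMap.range f).subtype g (Submodule.subtype_injective _) hg
    (by rw [LinearMap.exact_iff, Submodule.range_subtype, LinearMap.exact_iff.1 H])]
  gcongr
  exact Module.length_le_of_surjective f.rangeRestrict f.surjective_rangeRestrict

theorem Ideal.length_quotient_anti {I K : Ideal R} (h : I ≤ K) :
    Module.length R (R ⧸ K) ≤ Module.length R (R ⧸ I) :=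
  Module.length_le_of_surjective (Submodule.factor h) (Submodule.factor_surjective h)

/-- Multiplication by `x ^ a` makes `R / (I + x) → R / (I + x ^ (a + 1)) → R / (I + x ^ a) → 0`
exact. -/
theorem Ideal.length_quotient_sup_span_pow_le (I : Ideal R) (x : R) (a : ℕ) :
    Module.length R (R ⧸ I ⊔ Ideal.span {x ^ a}) ≤
      a * Module.length R (R ⧸ I ⊔ Ideal.span {x}) := by
  induction a with
  | zero =>
    have : I ⊔ Ideal.span {x ^ 0} = ⊤ := by simp
    rw [this]
    simp [Module.length_eq_zero]
  | succ a ih =>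
    let f : R ⧸ I ⊔ Ideal.span {x} →ₗ[R] R ⧸ I ⊔ Ideal.span {x ^ (a + 1)} :=
      Submodule.mapQ _ _ (LinearMap.mulLeft R (x ^ a)) (by
        rw [← Submodule.map_le_iff_le_comap, Submodule.map_sup, Ideal.span, Submodule.map_span]
        refine sup_le_sup ?_ ?_
        · rintro _ ⟨y, hy, rfl⟩
          exact I.mul_mem_left _ hy
        · rw [Set.image_singleton, LinearMap.mulLeft_apply, ← pow_succ])
    let g : R ⧸ I ⊔ Ideal.span {x ^ (a + 1)} →ₗ[R] R ⧸ I ⊔ Ideal.span {x ^ a} :=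
      Submodule.factor (sup_le_sup_left ((Ideal.span_singleton_le_span_singleton).2
        (pow_dvd_pow x a.le_succ)) I)
    have hfg : Function.Exact f g := by
      intro y
      obtain ⟨y, rfl⟩ := Submodule.Quotient.mk_surjective _ y
      constructor
      · intro hy
        have := (Submodule.Quotient.mk_eq_zero _).1 hy
        rw [sup_comm, Ideal.mem_span_singleton_sup] at this
        obtain ⟨t, b, hb, rfl⟩ := this
        refine ⟨Submodule.Quotient.mk t, (Submodule.Quotient.eq _).2 (Ideal.mem_sup_left ?_)⟩
        rw [LinearMap.mulLeft_apply, mul_comm t, sub_add_cancel_left]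
        exact I.neg_mem hb
      · rintro ⟨z, hz⟩
        obtain ⟨z, rfl⟩ := Submodule.Quotient.mk_surjective _ z
        rw [← hz]
        refine (Submodule.Quotient.mk_eq_zero _).2 (Ideal.mem_sup_right ?_)
        exact Ideal.mul_mem_right _ _ (Ideal.mem_span_singleton_self _)
    refine (Module.length_le_add_of_exact f g (Submodule.factor_surjective _) hfg).trans ?_
    push_cast
    rw [add_mul, one_mul, add_comm]
    gcongr

/-- `I` is arbitrary so that the other generators can be absorbed into it while one exponent
changes. -/
theorem Ideal.length_quotient_sup_ofList_pow_le (q : ℕ) (L : List R) : ∀ I : Ideal R,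
    Module.length R (R ⧸ I ⊔ Ideal.ofList (L.map (· ^ q))) ≤
      (q ^ L.length : ℕ) * Module.length R (R ⧸ I ⊔ Ideal.ofList L) := by
  induction L with
  | nil =>
    intro I
    rw [List.map_nil, List.length_nil, pow_zero, Nat.cast_one, one_mul]
  | cons x L ih =>
    intro I
    rw [List.map_cons, Ideal.ofList_cons, ← sup_assoc, Ideal.ofList_cons]
    refine (ih _).trans ?_
    rw [sup_right_comm, List.length_cons, pow_succ, Nat.cast_mul, mul_assoc, ← sup_assoc,
      sup_right_comm I (Ideal.span {x})]
    gcongr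
    exact Ideal.length_quotient_sup_span_pow_le _ x q

theorem Module.length_span_range_le {M : Type*} [AddCommGroup M] [Module R M] {I : Ideal R}
    (hI : ∀ a ∈ I, ∀ x : M, a • x = 0) {n : ℕ} (w : Fin n → M) :
    Module.length R (Submodule.span R (Set.range w)) ≤ n * Module.length R (R ⧸ I) := by
  let f : (Fin n → R ⧸ I) →ₗ[R] M := ∑ i, (Submodule.liftQ I (LinearMap.toSpanSingleton R M (w i))
    (fun a ha => hI a ha _)) ∘ₗ LinearMap.proj i
  have hle : Submodule.span R (Set.range w) ≤ LinearMap.range f := by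
    rw [Submodule.span_le]
    rintro _ ⟨i, rfl⟩
    refine ⟨Pi.single i (Submodule.Quotient.mk 1), ?_⟩
    simp only [f, LinearMap.sum_apply, LinearMap.comp_apply, LinearMap.proj_apply]
    rw [Finset.sum_eq_single i]
    · rw [Pi.single_eq_same]
      exact one_smul R (w i)
    · intro j _ hj
      rw [Pi.single_eq_of_ne hj, map_zero]
    · simp
  calc Module.length R (Submodule.span R (Set.range w))
      ≤ Module.length R (LinearMap.range f) :=
        Module.length_le_of_injective (Submodule.inclusion hle) (Submodule.inclusion_injective hle)
    _ ≤ Module.length R (Fin n → R ⧸ I) :=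
        Module.length_le_of_surjective f.rangeRestrict f.surjective_rangeRestrict
    _ = n * Module.length R (R ⧸ I) := by rw [Module.length_pi_of_fintype]; simp

/-- If `c` kills `M` modulo the submodule spanned by `v` and `M` is generated by `n` elements, the
length of `M / I M` is bounded in terms of those of `R / I` and `R / (I + c)`. -/
theorem Module.length_quotient_smul_top_le {M : Type*} [AddCommGroup M] [Module R M] {r n : ℕ}
    (v : Fin r → M) (w : Fin n → M) (hw : Submodule.span R (Set.range w) = ⊤) {c : R}
    (hc : ∀ x, c • x ∈ Submodule.span R (Set.range v)) (I : Ideal R) :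
    Module.length R (M ⧸ (I • ⊤ : Submodule R M)) ≤ r * Module.length R (R ⧸ I) +
      n * Module.length R (R ⧸ I ⊔ Ideal.span {c}) := by
  set K : Submodule R M := I • ⊤
  have hK : ∀ a ∈ I, ∀ x : M ⧸ K, a • x = 0 := by
    intro a ha x
    obtain ⟨x, rfl⟩ := Submodule.Quotient.mk_surjective _ x
    exact (Submodule.Quotient.mk_eq_zero _).2 (Submodule.smul_mem_smul ha trivial)
  set N : Submodule R (M ⧸ K) := Submodule.span R (Set.range (K.mkQ ∘ v)) with hN
  have hNv : N = (Submodule.span R (Set.range v)).map K.mkQ := by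
    rw [hN, Submodule.map_span, Set.range_comp]
  rw [Module.length_eq_add_of_exact N.subtype N.mkQ (Submodule.subtype_injective _)
    (Submodule.mkQ_surjective _) (LinearMap.exact_subtype_mkQ N)]
  refine add_le_add (Module.length_span_range_le hK _) ?_
  -- Modulo `I M` and the images of `v`, what remains of `M` is killed by `I + (c)` and still has
  -- `n` generators.
  have hQ : ∀ a ∈ I ⊔ Ideal.span {c}, ∀ x : (M ⧸ K) ⧸ N, a • x = 0 := by
    intro a ha x
    obtain ⟨x, rfl⟩ := Submodule.Quotient.mk_surjective _ x
    obtain ⟨x, rfl⟩ := Submodule.Quotient.mk_surjective _ x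
    obtain ⟨b, hb, z, hz, rfl⟩ := Submodule.mem_sup.1 ha
    obtain ⟨z, rfl⟩ := Ideal.mem_span_singleton'.1 hz
    rw [← Submodule.Quotient.mk_smul, add_smul, hK b hb, zero_add, Submodule.Quotient.mk_eq_zero,
      hNv, mul_smul]
    exact N.smul_mem z (hNv ▸ Submodule.mem_map_of_mem (f := K.mkQ) (hc x)) |> (hNv ▸ ·)
  have hspan : Submodule.span R (Set.range (N.mkQ ∘ K.mkQ ∘ w)) = ⊤ := by
    rw [Set.range_comp, Set.range_comp, ← Submodule.map_span, ← Submodule.map_span, hw,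
      Submodule.map_top, Submodule.range_mkQ, Submodule.map_top, Submodule.range_mkQ]
  have := Module.length_span_range_le hQ (N.mkQ ∘ K.mkQ ∘ w)
  rwa [hspan, Module.length_top] at this

/-- There are at most as many independent elements as generators, and by Nakayama the minimal number
of generators is the dimension of `M / 𝔪 M`. -/
theorem LinearIndependent.card_le_length_quotient [IsLocalRing R] {M : Type*} [AddCommGroup M]
    [Module R M] [Module.Finite R M] {ι : Type*} [Fintype ι] {v : ι → M}
    (hv : LinearIndependent R v) :
    (Fintype.card ι : ℕ∞) ≤ Module.length R (M ⧸ (maximalIdeal R • ⊤ : Submodule R M)) := by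
  have hfg : (⊤ : Submodule R M).FG := Module.Finite.fg_top
  obtain ⟨s, hs, hspan⟩ := Submodule.FG.exists_span_finset_card_eq_spanFinrank hfg
  have h1 := linearIndependent_le_span v hv s hspan
  simp only [Cardinal.mk_fintype, Nat.cast_le, Finset.coe_sort_coe, Fintype.card_coe] at h1
  rw [hs, IsLocalRing.spanFinrank_eq_finrank_quotient _ hfg] at h1
  refine (Nat.cast_le.2 h1).trans ?_
  let := Ideal.Quotient.field (maximalIdeal R)
  have := Module.Finite.of_restrictScalars_finite R (R ⧸ maximalIdeal R)
    ((⊤ : Submodule R M) ⧸ maximalIdeal R • (⊤ : Submodule R (⊤ : Submodule R M)))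
  rw [← Module.length_eq_finrank, ← Module.length_eq_of_surjective (S := R)
    Ideal.Quotient.mk_surjective]
  refine le_of_eq (LinearEquiv.length_eq (Submodule.Quotient.equiv _ _ Submodule.topEquiv ?_))
  rw [Submodule.map_smul'']
  simp

end LengthBounds

/-! ### Growth of Frobenius colengths. -/

section ParameterBound

/-- `L` lifts a system of parameters of `R / I`: the maximal ideal becomes minimal over `I + (L)`,
so the quotient is Artinian. -/
theorem IsLocalRing.exists_list_of_ringKrullDim_quotient_le {R : Type*} [CommRing R]
    [IsLocalRing R] [IsNoetherianRing R] (I : Ideal R) [Nontrivial (R ⧸ I)] {t : ℕ}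
    (ht : ringKrullDim (R ⧸ I) ≤ t) : ∃ L : List R, L.length ≤ t ∧
      (∀ x ∈ L, x ∈ maximalIdeal R) ∧ Module.length R (R ⧸ I ⊔ Ideal.ofList L) ≠ ⊤ := by
  obtain ⟨s, hs, hcard⟩ :=
    (maximalIdeal (R ⧸ I)).exists_finset_card_eq_height_of_isNoetherianRing
  obtain ⟨L, hL⟩ := List.map_surjective_iff.2 (Ideal.Quotient.mk_surjective (I := I)) s.toList
  have hspan : Ideal.span (s : Set (R ⧸ I)) = (Ideal.ofList L).map (Ideal.Quotient.mk I) := by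
    rw [Ideal.map_ofList, hL, Ideal.ofList]
    congr 1
    ext; simp
  have hI : I ≤ maximalIdeal R := le_maximalIdeal (Ideal.Quotient.nontrivial_iff.1 inferInstance)
  have hcomap : (maximalIdeal (R ⧸ I)).comap (Ideal.Quotient.mk I) = maximalIdeal R := by
    rw [← map_mk_maximalIdeal, Ideal.comap_map_of_surjective _ Ideal.Quotient.mk_surjective,
      ← RingHom.ker_eq_comap_bot, Ideal.mk_ker, sup_eq_left.2 hI]
  have hLm : Ideal.ofList L ≤ maximalIdeal R := by
    rw [← hcomap, ← Ideal.map_le_iff_le_comap, ← hspan]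
    exact hs.1.2
  refine ⟨L, ?_, fun x hx => hLm (Ideal.subset_span hx), ?_⟩
  · rw [← maximalIdeal_height_eq_ringKrullDim, ← hcard] at ht
    have h1 : s.card ≤ t := by exact_mod_cast ht
    rwa [← Finset.length_toList, ← hL, List.length_map] at h1
  · have hmin : maximalIdeal R ∈ (I ⊔ Ideal.ofList L).minimalPrimes := by
      refine ⟨⟨inferInstance, sup_le hI hLm⟩, fun P hP hPm => ?_⟩
      have hPprime := hP.1
      have hPI : RingHom.ker (Ideal.Quotient.mk I) ≤ P := by
        rw [Ideal.mk_ker]; exact le_sup_left.trans hP.2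
      have h1 := hs.2 (y := P.map (Ideal.Quotient.mk I))
        ⟨Ideal.map_isPrime_of_surjective Ideal.Quotient.mk_surjective hPI,
          hspan ▸ Ideal.map_mono (le_sup_right.trans hP.2)⟩
        (map_mk_maximalIdeal I ▸ Ideal.map_mono hPm)
      have h2 := Ideal.comap_mono (f := Ideal.Quotient.mk I) h1
      rwa [hcomap, Ideal.comap_map_of_surjective _ Ideal.Quotient.mk_surjective,
        ← RingHom.ker_eq_comap_bot, sup_eq_left.2 hPI] at h2
    have := IsLocalRing.quotient_artinian_of_mem_minimalPrimes_of_isLocalRing _ hmin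
    rw [Module.length_eq_of_surjective (R := R ⧸ I ⊔ Ideal.ofList L) Ideal.Quotient.mk_surjective]
    exact Module.length_ne_top

/-- The length of the quotient by `I + 𝔪^[p^e]` is `O(p^{e dim R/I})`. -/
theorem exists_length_quotient_sup_frobeniusPower_le (p : ℕ) [Fact p.Prime] {R : Type*}
    [CommRing R] [IsLocalRing R] [IsNoetherianRing R] [CharP R p] (I : Ideal R) {t : ℕ}
    (ht : ringKrullDim (R ⧸ I) ≤ t) : ∃ C : ℕ, ∀ e : ℕ,
      Module.length R (R ⧸ I ⊔ frobeniusPower p e (maximalIdeal R)) ≤ (C * (p ^ e) ^ t : ℕ) := by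
  rcases subsingleton_or_nontrivial (R ⧸ I) with h | h
  · refine ⟨0, fun e => ?_⟩
    rw [Ideal.Quotient.subsingleton_iff.1 h, top_sup_eq]
    simp [Module.length_eq_zero]
  obtain ⟨L, hLt, hLm, hfin⟩ := exists_list_of_ringKrullDim_quotient_le I ht
  obtain ⟨C, hC⟩ := ENat.ne_top_iff_exists.1 hfin
  refine ⟨C, fun e => ?_⟩
  have hle : I ⊔ Ideal.ofList (L.map (· ^ p ^ e)) ≤ I ⊔ frobeniusPower p e (maximalIdeal R) := by
    refine sup_le_sup_left (Ideal.span_le.2 fun y hy => ?_) I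
    obtain ⟨x, hx, rfl⟩ := List.mem_map.1 hy
    exact Ideal.mem_map_of_mem (iterateFrobenius R p e) (hLm x hx)
  refine (Ideal.length_quotient_anti hle).trans
    ((Ideal.length_quotient_sup_ofList_pow_le _ _ _).trans ?_)
  rw [← hC, mul_comm C]
  exact_mod_cast Nat.mul_le_mul_right C
    (Nat.pow_le_pow_right (pow_pos (Fact.out : p.Prime).pos e) hLt)

end ParameterBound

/-! ### Elements of the nonsplitting ideals. -/

section NonsplittingIdeal

open FrobeniusAlgebra

variable (p e : ℕ) [Fact p.Prime] (R : Type*) [CommRing R] [IsLocalRing R] [CharP R p]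

variable {R} in
theorem mem_nonsplittingIdeal {x : R} : x ∈ nonsplittingIdeal p e R ↔
    ∀ φ : FrobeniusAlgebra p e R →ₗ[R] R, φ (ringEquiv p e R x) ∈ maximalIdeal R := Iff.rfl

theorem frobeniusPower_maximalIdeal_le_nonsplittingIdeal :
    frobeniusPower p e (maximalIdeal R) ≤ nonsplittingIdeal p e R := by
  refine Ideal.map_le_iff_le_comap.2 fun r hr => (mem_nonsplittingIdeal p e).2 fun φ => ?_
  have : ringEquiv p e R (r ^ p ^ e) = r • ringEquiv p e R 1 := by rw [smul_ringEquiv, mul_one]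
  change φ (ringEquiv p e R (r ^ p ^ e)) ∈ maximalIdeal R
  rw [this, map_smul]
  exact Ideal.mul_mem_right _ _ hr

/-- The `p`-th power map as a linear map `F^e_* R → F^{e+1}_* R` over `R`. -/
def FrobeniusAlgebra.powMap (p e : ℕ) (R : Type*) [CommRing R] [ExpChar R p] :
    FrobeniusAlgebra p e R →ₗ[R] FrobeniusAlgebra p (e + 1) R where
  toFun x := ringEquiv p (e + 1) R ((ringEquiv p e R).symm x ^ p)
  map_add' x y := by rw [map_add, add_pow_expChar, map_add]
  map_smul' r x := by
    obtain ⟨x, rfl⟩ := (ringEquiv p e R).surjective x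
    rw [smul_ringEquiv, RingHom.id_apply, RingEquiv.symm_apply_apply, RingEquiv.symm_apply_apply,
      smul_ringEquiv, mul_pow, ← pow_mul, pow_succ]

theorem FrobeniusAlgebra.powMap_ringEquiv (p e : ℕ) (R : Type*) [CommRing R] [ExpChar R p] (x : R) :
    powMap p e R (ringEquiv p e R x) = ringEquiv p (e + 1) R (x ^ p) := rfl

/-- A functional on `F^{e+1}_* R` restricts along the `p`-th power map to one on `F^e_* R`. -/
theorem frobeniusPower_nonsplittingIdeal_le :
    frobeniusPower p 1 (nonsplittingIdeal p e R) ≤ nonsplittingIdeal p (e + 1) R := by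
  refine Ideal.map_le_iff_le_comap.2 fun x hx => (mem_nonsplittingIdeal p (e + 1)).2 fun φ => ?_
  change φ (ringEquiv p (e + 1) R (x ^ p ^ 1)) ∈ maximalIdeal R
  rw [pow_one, ← FrobeniusAlgebra.powMap_ringEquiv]
  exact hx (φ ∘ₗ powMap p e R)

variable {R}

/-- An element with a unit value under some functional has zero annihilator, while `b` kills `F^e_*
c`. -/
theorem mem_nonsplittingIdeal_of_mul_eq_zero {b c : R} (hb : b ≠ 0) (h : b * c = 0) :
    c ∈ nonsplittingIdeal p e R := by
  refine (mem_nonsplittingIdeal p e).2 fun φ => ?_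
  by_contra hφ
  have h1 : b • ringEquiv p e R c = 0 := by
    have : p ^ e ≠ 0 := pow_ne_zero _ (Fact.out : p.Prime).ne_zero
    rw [smul_ringEquiv, ← Nat.succ_pred_eq_of_ne_zero this, pow_succ, mul_assoc, h, mul_zero,
      map_zero]
  have h2 : b * φ (ringEquiv p e R c) = 0 := by rw [← smul_eq_mul, ← map_smul, h1, map_zero]
  exact hb ((notMem_maximalIdeal.1 hφ).mul_left_eq_zero.1 h2)

/-- An element `b ≠ 0` with `b ^ 2 = 0` acts on `F^e_* R` as `b ^ (p ^ e) = 0`; this needs `p ^ e ≥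
2`, hence `e ≠ 0`. -/
theorem nonsplittingIdeal_eq_top_of_not_isReduced (h : ¬ IsReduced R) (he : e ≠ 0) :
    nonsplittingIdeal p e R = ⊤ := by
  obtain ⟨b, hb2, hb⟩ : ∃ b : R, b ^ 2 = 0 ∧ b ≠ 0 := by
    by_contra! hcon
    exact h ((isReduced_iff_pow_one_lt 2 one_lt_two).2 hcon)
  rw [Ideal.eq_top_iff_one, mem_nonsplittingIdeal]
  intro φ
  by_contra hφ
  have h1 : b • ringEquiv p e R 1 = 0 := by
    have : 2 ≤ p ^ e := (Fact.out : p.Prime).two_le.trans (Nat.le_self_pow he p)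
    rw [smul_ringEquiv, pow_eq_zero_of_le this hb2, zero_mul, map_zero]
  have h2 : b * φ (ringEquiv p e R 1) = 0 := by rw [← smul_eq_mul, ← map_smul, h1, map_zero]
  exact hb ((notMem_maximalIdeal.1 hφ).mul_left_eq_zero.1 h2)

end NonsplittingIdeal

/-! ### Convergence, and the case of a ring that is not a domain. -/

section Limit

open FrobeniusAlgebra

theorem tendsto_of_le_add_geometric {u : ℕ → ℝ} (h0 : ∀ e, 0 ≤ u e) {C : ℝ} {p : ℕ} (hp : 2 ≤ p)
    (hC : 0 ≤ C) (h : ∀ e, u (e + 1) ≤ u e + C / (p : ℝ) ^ e) :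
    ∃ s, Tendsto u atTop (𝓝 s) := by
  have hp0 : (0 : ℝ) < p := by positivity
  have hp2 : (2 : ℝ) ≤ p := by exact_mod_cast hp
  -- Adding `2 C / p ^ e` absorbs the error, because `2 C / p ^ (e + 1) ≤ C / p ^ e` for `p ≥ 2`.
  have hanti : Antitone fun e => u e + 2 * C / (p : ℝ) ^ e := antitone_nat_of_succ_le fun e => by
    have h1 : 2 * C / (p : ℝ) ^ (e + 1) ≤ C / (p : ℝ) ^ e := by
      rw [div_le_div_iff₀ (by positivity) (by positivity), pow_succ]
      have : 0 ≤ C * (p : ℝ) ^ e := by positivity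
      nlinarith
    have h2 : 2 * C / (p : ℝ) ^ e = C / (p : ℝ) ^ e + C / (p : ℝ) ^ e := by ring
    have := h e
    rw [h2]
    linarith
  have hbdd : BddBelow (Set.range fun e => u e + 2 * C / (p : ℝ) ^ e) := ⟨0, by
    rintro _ ⟨e, rfl⟩
    have := h0 e
    positivity⟩
  have hlim := tendsto_atTop_ciInf hanti hbdd
  have hz : Tendsto (fun e : ℕ => 2 * C / (p : ℝ) ^ e) atTop (𝓝 0) :=
    tendsto_const_nhds.div_atTop (tendsto_pow_atTop_atTop_of_one_lt (by linarith))
  exact ⟨_, by simpa using hlim.sub hz⟩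

variable (p : ℕ) [Fact p.Prime] (R : Type*) [CommRing R] [IsLocalRing R] [CharP R p]

/-- The length of `R / I_e`, where `I_e` is the nonsplitting ideal. -/
noncomputable def splittingLength (e : ℕ) : ℕ :=
  (Module.length R (R ⧸ nonsplittingIdeal p e R)).toNat

variable {R}

theorem coe_splittingLength (h : IsFFinite p R) (e : ℕ) :
    (splittingLength p R e : ℕ∞) = Module.length R (R ⧸ nonsplittingIdeal p e R) :=
  ENat.natCast_toNat (length_quotient_nonsplittingIdeal_ne_top p e R h)

theorem tendsto_splittingLength_of_not_isReduced (h : ¬ IsReduced R) (d : ℕ) :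
    Tendsto (fun e => (splittingLength p R e : ℝ) / (p : ℝ) ^ (e * d)) atTop (𝓝 0) := by
  refine tendsto_const_nhds.congr' ?_
  filter_upwards [eventually_ne_atTop 0] with e he
  rw [splittingLength, nonsplittingIdeal_eq_top_of_not_isReduced p e h he]
  simp [Module.length_eq_zero]

/-- Minimal primes consist of zero divisors, so they lie in every `I_e`. For minimal primes `P` and
`Q` with `y ∈ Q \ P`, the ring `R / (P + (y))` has dimension less than `d`, which costs a factor `p
^ e` in the growth. -/
theorem tendsto_splittingLength_of_not_isDomain [IsNoetherianRing R] [IsReduced R]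
    (h : ¬ IsDomain R) (hF : IsFFinite p R) (d : ℕ) (hd : ringKrullDim R = d) :
    Tendsto (fun e => (splittingLength p R e : ℝ) / (p : ℝ) ^ (e * d)) atTop (𝓝 0) := by
  have hp : p.Prime := Fact.out
  obtain ⟨P, hP, Q, hQ, hPQ⟩ : ∃ P ∈ minimalPrimes R, ∃ Q ∈ minimalPrimes R, ¬ Q ≤ P := by
    by_contra! hcon
    obtain ⟨P, hP⟩ := Ideal.nonempty_minimalPrimes (I := (⊥ : Ideal R)) bot_ne_top
    -- A minimal prime contained in all others would be the nilradical, which is zero.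
    have hle : P ≤ sInf (minimalPrimes R) := le_sInf fun Q hQ => hcon Q hQ P hP
    have hbot : P = ⊥ := by
      rw [eq_bot_iff]
      refine hle.trans ?_
      rw [minimalPrimes, Ideal.sInf_minimalPrimes]
      exact (nilradical_eq_zero R).le
    have := Ideal.IsMinimalPrime.isPrime hP
    rw [hbot] at this
    exact h (IsDomain.of_bot_isPrime R)
  obtain ⟨y, hyQ, hyP⟩ := Set.not_subset.1 hPQ
  have hmem : ∀ P' ∈ minimalPrimes R, ∀ x ∈ P', ∀ e, x ∈ nonsplittingIdeal p e R := by
    intro P' hP' x hx e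
    have h1 : x ∉ nonZeroDivisors R := fun hx' =>
      Set.disjoint_left.1 (Ideal.disjoint_nonZeroDivisors_of_mem_minimalPrimes hP') hx hx'
    rw [mem_nonZeroDivisors_iff_right] at h1
    push Not at h1
    obtain ⟨b, hb, hb0⟩ := h1
    exact mem_nonsplittingIdeal_of_mul_eq_zero p e hb0 hb
  set I : Ideal R := P ⊔ Ideal.span {y} with hI
  have hIle : ∀ e, I ≤ nonsplittingIdeal p e R := fun e => sup_le (fun x hx => hmem P hP x hx e)
    ((Ideal.span_singleton_le_iff_mem _).2 (hmem Q hQ y hyQ e))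
  have hPprime := Ideal.IsMinimalPrime.isPrime hP
  have hQprime := Ideal.IsMinimalPrime.isPrime hQ
  have hIm : I ≤ maximalIdeal R := sup_le (le_maximalIdeal hPprime.ne_top)
    ((Ideal.span_singleton_le_iff_mem _).2 (le_maximalIdeal hQprime.ne_top hyQ))
  have hdim : ringKrullDim (R ⧸ I) + 1 ≤ d := by
    rw [← hd]
    refine le_trans ?_ (ringKrullDim_quotient_le P)
    refine ringKrullDim_succ_le_of_surjective (Ideal.Quotient.factor le_sup_left)
      (Ideal.Quotient.factor_surjective le_sup_left) (r := Ideal.Quotient.mk P y)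
      (mem_nonZeroDivisors_of_ne_zero ?_) ?_
    · rwa [Ne, Ideal.Quotient.eq_zero_iff_mem]
    · rw [Ideal.Quotient.factor_mk, Ideal.Quotient.eq_zero_iff_mem]
      exact Ideal.mem_sup_right (Ideal.mem_span_singleton_self y)
  have hnt : Nontrivial (R ⧸ I) := Ideal.Quotient.nontrivial_iff.2
    fun h => (maximalIdeal.isMaximal R).ne_top (top_le_iff.1 (h ▸ hIm))
  obtain ⟨t, rfl⟩ : ∃ t, d = t + 1 := by
    refine Nat.exists_eq_succ_of_ne_zero ?_
    rintro rfl
    have := (add_le_add_left (ringKrullDim_nonneg_of_nontrivial (R := R ⧸ I)) 1).trans hdim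
    exact absurd this (by norm_num)
  have hdim' : ringKrullDim (R ⧸ I) ≤ t :=
    (ENat.WithBot.add_le_add_natCast_right_iff (c := 1)).1 (by simpa using hdim)
  obtain ⟨C, hC⟩ := exists_length_quotient_sup_frobeniusPower_le p I hdim'
  have hbound : ∀ e, splittingLength p R e ≤ C * (p ^ e) ^ t := by
    intro e
    have := (Ideal.length_quotient_anti (sup_le (hIle e)
      (frobeniusPower_maximalIdeal_le_nonsplittingIdeal p e R))).trans (hC e)
    rw [← coe_splittingLength p hF] at this
    exact_mod_cast this
  have hp1 : (1 : ℝ) < p := by exact_mod_cast hp.one_lt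
  refine squeeze_zero (fun e => by positivity) (fun e => ?_)
    (tendsto_const_nhds.div_atTop (tendsto_pow_atTop_atTop_of_one_lt hp1) :
      Tendsto (fun e : ℕ => (C : ℝ) / (p : ℝ) ^ e) atTop (𝓝 0))
  rw [div_le_div_iff₀ (by positivity) (by positivity)]
  have h1 : (splittingLength p R e : ℝ) ≤ C * ((p : ℝ) ^ e) ^ t := by exact_mod_cast hbound e
  calc (splittingLength p R e : ℝ) * (p : ℝ) ^ e ≤ C * ((p : ℝ) ^ e) ^ t * (p : ℝ) ^ e := by gcongr
    _ = C * (p : ℝ) ^ (e * (t + 1)) := by rw [mul_add, pow_add, pow_mul, mul_one, mul_assoc]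

end Limit

/-! ### The case of a domain. -/

section Domain

open FrobeniusAlgebra

variable (p : ℕ) [Fact p.Prime] {R : Type*} [CommRing R] [CharP R p]

/-- Independent elements of `F_* R` give independent elements of `F^e_* R`. -/
theorem FrobeniusAlgebra.exists_linearIndependent {r : ℕ} {v : Fin r → FrobeniusAlgebra p 1 R}
    (hv : LinearIndependent R v) (e : ℕ) : ∃ (ι : Type) (_ : Fintype ι)
      (w : ι → FrobeniusAlgebra p e R), Fintype.card ι = r ^ e ∧ LinearIndependent R w := by
  induction e with
  | zero =>
    refine ⟨Unit, inferInstance, fun _ => ringEquiv p 0 R 1, by simp, ?_⟩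
    rw [Fintype.linearIndependent_iff]
    intro g hg i
    rw [Fintype.sum_unique, smul_ringEquiv, pow_zero, pow_one, mul_one,
      map_eq_zero_iff _ (RingEquiv.injective _)] at hg
    exact hg
  | succ e ih =>
    obtain ⟨ι, hι, w, hcard, hw⟩ := ih
    refine ⟨Fin r × ι, inferInstance, fun i => ringEquiv p (e + 1) R
      ((ringEquiv p 1 R).symm (v i.1) * ((ringEquiv p e R).symm (w i.2)) ^ p), ?_, ?_⟩
    · rw [Fintype.card_prod, hcard, Fintype.card_fin, pow_succ']
    · rw [Fintype.linearIndependent_iff] at hv hw ⊢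
      intro g hg
      have hsmul : ∀ (n : ℕ) (a : R) (y : FrobeniusAlgebra p n R),
          (ringEquiv p n R).symm (a • y) = a ^ p ^ n * (ringEquiv p n R).symm y := fun n a y => by
        obtain ⟨y, rfl⟩ := (ringEquiv p n R).surjective y
        rw [smul_ringEquiv, RingEquiv.symm_apply_apply, RingEquiv.symm_apply_apply]
      -- As for bases in a tower of fields, the family is `v_i w_j ^ p`. Grouping a relation by `i`
      -- gives `∑ b_i ^ p v_i = 0`, a relation among the `v_i` in `F_* R`.
      set b : Fin r → R := fun i => (ringEquiv p e R).symm (∑ j, g (i, j) • w j) with hb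
      have h1 : ∑ i, b i • v i = 0 := by
        refine (ringEquiv p 1 R).symm.injective ?_
        refine (ringEquiv p (e + 1) R).injective ?_
        rw [map_zero, map_zero, ← hg, map_sum, map_sum, Fintype.sum_prod_type]
        refine Finset.sum_congr rfl fun i _ => ?_
        rw [hsmul, pow_one, hb]
        simp only [map_sum, hsmul]
        rw [sum_pow_char, Finset.sum_mul, map_sum]
        refine Finset.sum_congr rfl fun j _ => ?_
        rw [smul_ringEquiv, mul_pow, ← pow_mul, ← pow_succ]
        congr 1
        ring
      rintro ⟨i, j⟩
      have h2 := hv b h1 i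
      rw [hb, map_eq_zero_iff _ (RingEquiv.injective _)] at h2
      exact hw _ h2 j

theorem Nat.le_of_pow_le_mul_pow {r K C : ℕ} (hK : 0 < K) (h : ∀ e : ℕ, r ^ e ≤ C * K ^ e) :
    r ≤ K := by
  by_contra! hlt
  have h1 : (1 : ℝ) < (r : ℝ) / K := by
    rw [one_lt_div (by positivity)]; exact_mod_cast hlt
  obtain ⟨e, he⟩ := pow_unbounded_of_one_lt (C : ℝ) h1
  rw [div_pow, lt_div_iff₀ (by positivity)] at he
  exact absurd (h e) (not_le.2 (by exact_mod_cast he))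

variable [IsLocalRing R] [IsNoetherianRing R]

/-- The generic rank of `F_* R` is at most `[k : k ^ p] p ^ d`. -/
theorem finrank_frobeniusAlgebra_one_le (hF : IsFFinite p R) (d : ℕ) (hd : ringKrullDim R = d) :
    Module.finrank R (FrobeniusAlgebra p 1 R) ≤ residueFrobeniusDegree p R * p ^ d := by
  obtain ⟨v, hv⟩ := exists_linearIndependent_of_le_finrank
    (le_refl (Module.finrank R (FrobeniusAlgebra p 1 R)))
  obtain ⟨C, hC⟩ := exists_length_quotient_sup_frobeniusPower_le p (⊥ : Ideal R) (t := d)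
    ((ringKrullDim_quotient_le _).trans hd.le)
  -- For `r` the rank, `F^e_* R` has `r ^ e` independent elements, so `r ^ e ≤ κ ^ e ℓ(R / 𝔪^[p^e])
  -- ≤ C (κ p ^ d) ^ e` for all `e`; comparing growth rates bounds `r`.
  refine Nat.le_of_pow_le_mul_pow (C := C) (mul_pos (residueFrobeniusDegree_pos p R hF)
    (pow_pos (Fact.out : p.Prime).pos d)) fun e => ?_
  have := finite_of_isFFinite p e R hF
  obtain ⟨ι, _, w, hcard, hw⟩ := FrobeniusAlgebra.exists_linearIndependent p hv e
  have h1 := hw.card_le_length_quotient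
  rw [Ideal.smul_top_eq_map, (Submodule.Quotient.restrictScalarsEquiv R _).length_eq,
    map_algebraMap_frobeniusAlgebra, length_quotient_frobeniusAlgebra p e R hF, hcard] at h1
  have h2 := hC e
  rw [bot_sup_eq] at h2
  have h3 := h1.trans (mul_le_mul_left h2 _)
  rw [mul_pow, ← pow_mul, mul_comm d, pow_mul]
  have h4 : Module.finrank R (FrobeniusAlgebra p 1 R) ^ e ≤
      C * (p ^ e) ^ d * residueFrobeniusDegree p R ^ e := by exact_mod_cast h3
  calc _ ≤ _ := h4
    _ = _ := by ring

/-- The length of the quotient by `c` and `𝔪^[p^e]` is `O(p^{e(d-1)})`. -/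
theorem exists_length_quotient_span_le [IsDomain R] (d : ℕ) (hd : ringKrullDim R = d)
    {c : R} (hc : c ≠ 0) :
    ∃ C : ℕ, ∀ e : ℕ, Module.length R (R ⧸ Ideal.span {c} ⊔ frobeniusPower p e (maximalIdeal R)) *
      (p ^ e : ℕ) ≤ (C * (p ^ e) ^ d : ℕ) := by
  by_cases hu : IsUnit c
  · refine ⟨0, fun e => ?_⟩
    rw [Ideal.span_singleton_eq_top.2 hu, top_sup_eq]
    simp [Module.length_eq_zero]
  have hnt : Nontrivial (R ⧸ Ideal.span {c}) :=
    Ideal.Quotient.nontrivial_iff.2 fun h => hu (Ideal.span_singleton_eq_top.1 h)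
  have hdim : ringKrullDim (R ⧸ Ideal.span {c}) + 1 ≤ d := hd ▸
    ringKrullDim_quotient_succ_le_of_nonZeroDivisor (mem_nonZeroDivisors_of_ne_zero hc)
  obtain ⟨t, rfl⟩ : ∃ t, d = t + 1 := by
    refine Nat.exists_eq_succ_of_ne_zero ?_
    rintro rfl
    have := (add_le_add_left (ringKrullDim_nonneg_of_nontrivial
      (R := R ⧸ Ideal.span {c})) 1).trans hdim
    exact absurd this (by norm_num)
  obtain ⟨C, hC⟩ := exists_length_quotient_sup_frobeniusPower_le p (Ideal.span {c}) (t := t)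
    ((ENat.WithBot.add_le_add_natCast_right_iff (c := 1)).1 (by simpa using hdim))
  refine ⟨C, fun e => (mul_le_mul_left (hC e) _).trans ?_⟩
  rw [pow_succ, ← mul_assoc]
  exact_mod_cast le_rfl

/-- A maximal independent family spans `N ⊆ F_* R` with torsion quotient, killed by some `c ≠ 0`.
Bounding the length of `F_* R / I_e F_* R = F_*(R / I_e^[p])` by means of `N` and `c`, and using
`I_e^[p] ⊆ I_{e+1}`, leaves an error of order `ℓ(R / ((c) + 𝔪^[p^e]))`. The extra factor `p ^ e`
avoids the exponent `d - 1`. -/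
theorem exists_mul_splittingLength_succ_le [IsDomain R] (hF : IsFFinite p R) (d : ℕ)
    (hd : ringKrullDim R = d) :
    ∃ C : ℕ, ∀ e : ℕ, residueFrobeniusDegree p R * splittingLength p R (e + 1) * p ^ e ≤
      residueFrobeniusDegree p R * p ^ d * splittingLength p R e * p ^ e + C * (p ^ e) ^ d := by
  have hfin := finite_of_isFFinite p 1 R hF
  obtain ⟨v, hv⟩ := exists_linearIndependent_of_le_finrank
    (le_refl (Module.finrank R (FrobeniusAlgebra p 1 R)))
  obtain ⟨n, w, hw⟩ := Module.Finite.exists_fin (R := R) (M := FrobeniusAlgebra p 1 R)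
  set N := Submodule.span R (Set.range v) with hN
  have htors : Module.IsTorsion R (FrobeniusAlgebra p 1 R ⧸ N) := by
    rw [← Module.finrank_eq_zero_iff_isTorsion]
    have h1 := rank_quotient_add_rank_of_isDomain N
    rw [← Module.finrank_eq_rank, ← Module.finrank_eq_rank, ← Module.finrank_eq_rank] at h1
    have h2 : Module.finrank R N = _ := finrank_span_eq_card hv
    rw [h2, Fintype.card_fin] at h1
    have h3 : Module.finrank R (FrobeniusAlgebra p 1 R ⧸ N) +
      Module.finrank R (FrobeniusAlgebra p 1 R) = Module.finrank R (FrobeniusAlgebra p 1 R) := by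
        exact_mod_cast h1
    omega
  obtain ⟨c, hcann, hc0⟩ := Submodule.annihilator_top_inter_nonZeroDivisors htors
  have hc : ∀ x, c • x ∈ N := fun x => by
    rw [← Submodule.Quotient.mk_eq_zero, Submodule.Quotient.mk_smul]
    exact Submodule.mem_annihilator.1 hcann _ trivial
  obtain ⟨C, hC⟩ := exists_length_quotient_span_le p d hd (nonZeroDivisors.ne_zero hc0)
  refine ⟨n * C, fun e => ?_⟩
  have h1 := Module.length_quotient_smul_top_le v w hw hc (nonsplittingIdeal p e R)
  rw [Ideal.smul_top_eq_map, (Submodule.Quotient.restrictScalarsEquiv R _).length_eq,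
    map_algebraMap_frobeniusAlgebra, length_quotient_frobeniusAlgebra p 1 R hF, pow_one] at h1
  have h2 := Ideal.length_quotient_anti (frobeniusPower_nonsplittingIdeal_le p e R)
  rw [← coe_splittingLength p hF] at h1 h2
  have h3 : Module.length R (R ⧸ nonsplittingIdeal p e R ⊔ Ideal.span {c}) ≤
      Module.length R (R ⧸ Ideal.span {c} ⊔ frobeniusPower p e (maximalIdeal R)) := by
    refine Ideal.length_quotient_anti ?_
    rw [sup_comm]
    exact sup_le_sup_right (frobeniusPower_maximalIdeal_le_nonsplittingIdeal p e R) _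
  have h4 : (Module.finrank R (FrobeniusAlgebra p 1 R) : ℕ∞) ≤
      (residueFrobeniusDegree p R * p ^ d : ℕ) :=
    Nat.cast_le.2 (finrank_frobeniusAlgebra_one_le p hF d hd)
  have key : (residueFrobeniusDegree p R * splittingLength p R (e + 1) * p ^ e : ℕ∞) ≤
      residueFrobeniusDegree p R * p ^ d * splittingLength p R e * p ^ e +
        n * C * (p ^ e) ^ d := by
    calc (residueFrobeniusDegree p R * splittingLength p R (e + 1) * p ^ e : ℕ∞)
        ≤ ((residueFrobeniusDegree p R * p ^ d : ℕ) * splittingLength p R e +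
          n * Module.length R (R ⧸ Ideal.span {c} ⊔ frobeniusPower p e (maximalIdeal R))) *
            p ^ e := by
          gcongr
          rw [mul_comm]
          refine ((mul_le_mul_left h2 _).trans h1).trans ?_
          gcongr
      _ = residueFrobeniusDegree p R * p ^ d * splittingLength p R e * p ^ e +
          n * (Module.length R (R ⧸ Ideal.span {c} ⊔ frobeniusPower p e (maximalIdeal R)) *
            (p ^ e : ℕ)) := by push_cast; ring
      _ ≤ residueFrobeniusDegree p R * p ^ d * splittingLength p R e * p ^ e +
          n * (C * (p ^ e) ^ d : ℕ) := by gcongr; exact hC e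
      _ = _ := by push_cast; ring
  exact_mod_cast key

theorem tendsto_splittingLength_of_isDomain [IsDomain R] (hF : IsFFinite p R) (d : ℕ)
    (hd : ringKrullDim R = d) : ∃ s : ℝ,
      Tendsto (fun e => (splittingLength p R e : ℝ) / (p : ℝ) ^ (e * d)) atTop (𝓝 s) := by
  have hp : p.Prime := Fact.out
  have hp0 : (0 : ℝ) < p := by exact_mod_cast hp.pos
  obtain ⟨C, hC⟩ := exists_mul_splittingLength_succ_le p hF d hd
  refine tendsto_of_le_add_geometric (p := p) (C := C) (fun e => by positivity) hp.two_le
    (by positivity) fun e => ?_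
  have hκ : (1 : ℝ) ≤ residueFrobeniusDegree p R := by
    exact_mod_cast residueFrobeniusDegree_pos p R hF
  have h1 : (residueFrobeniusDegree p R : ℝ) * splittingLength p R (e + 1) * (p : ℝ) ^ e ≤
      residueFrobeniusDegree p R * (p : ℝ) ^ d * splittingLength p R e * (p : ℝ) ^ e +
        C * ((p : ℝ) ^ e) ^ d := by exact_mod_cast hC e
  have hpd : (1 : ℝ) ≤ (p : ℝ) ^ d := one_le_pow₀ (by exact_mod_cast hp.one_le)
  have hCq : (0 : ℝ) ≤ C * ((p : ℝ) ^ e) ^ d := by positivity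
  have h2 : (residueFrobeniusDegree p R : ℝ) * (splittingLength p R (e + 1) * (p : ℝ) ^ e) ≤
      residueFrobeniusDegree p R * ((p : ℝ) ^ d * splittingLength p R e * (p : ℝ) ^ e +
        C * ((p : ℝ) ^ e) ^ d * (p : ℝ) ^ d) := by
    -- Division by `κ p ^ d ≥ 1` only shrinks the error, so the constant `C` can be kept.
    have h3 : C * ((p : ℝ) ^ e) ^ d ≤
        residueFrobeniusDegree p R * (C * ((p : ℝ) ^ e) ^ d * (p : ℝ) ^ d) := by
      calc C * ((p : ℝ) ^ e) ^ d = 1 * (C * ((p : ℝ) ^ e) ^ d * 1) := by ring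
        _ ≤ _ := by gcongr
    linarith
  have h4 := le_of_mul_le_mul_left h2 (by linarith)
  have h5 : (splittingLength p R e : ℝ) / (p : ℝ) ^ (e * d) + C / (p : ℝ) ^ e =
      ((p : ℝ) ^ d * splittingLength p R e * (p : ℝ) ^ e + C * ((p : ℝ) ^ e) ^ d * (p : ℝ) ^ d) /
        ((p : ℝ) ^ ((e + 1) * d) * (p : ℝ) ^ e) := by
    rw [add_mul, one_mul, pow_add, pow_mul]
    field_simp
  rw [h5, le_div_iff₀ (by positivity)]
  calc _ = splittingLength p R (e + 1) * (p : ℝ) ^ e := by field_simp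
    _ ≤ _ := h4

end Domain

theorem exists_tendsto_splittingLength (p : ℕ) [Fact p.Prime] {R : Type*} [CommRing R]
    [IsLocalRing R] [IsNoetherianRing R] [CharP R p] (hF : IsFFinite p R) (d : ℕ)
    (hd : ringKrullDim R = d) : ∃ s : ℝ,
      Tendsto (fun e => (splittingLength p R e : ℝ) / (p : ℝ) ^ (e * d)) atTop (𝓝 s) := by
  by_cases hred : IsReduced R
  · by_cases hdom : IsDomain R
    · exact tendsto_splittingLength_of_isDomain p hF d hd
    · exact ⟨0, tendsto_splittingLength_of_not_isDomain p hdom hF d hd⟩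
  · exact ⟨0, tendsto_splittingLength_of_not_isReduced p hred d⟩

/-! ### Assembly: `F`-finiteness of quotients and the normalization by `α(R)`. -/

section Main

open FrobeniusAlgebra

theorem IsFFinite.quotient {p : ℕ} [Fact p.Prime] {S : Type*} [CommRing S] [CharP S p]
    (h : IsFFinite p S) (J : Ideal S) [Nontrivial (S ⧸ J)] : IsFFinite p (S ⧸ J) := by
  have : Module.Finite S (FrobeniusPushforward p 1 S) := h
  let f : FrobeniusPushforward p 1 S →ₛₗ[Ideal.Quotient.mk J] FrobeniusPushforward p 1 (S ⧸ J) :=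
    { toFun := fun x => FrobeniusPushforward.of p 1 (S ⧸ J)
        (Ideal.Quotient.mk J ((FrobeniusPushforward.of p 1 S).symm x))
      map_add' := fun x y => by simp only [map_add]
      map_smul' := fun r x => by
        obtain ⟨x, rfl⟩ := (FrobeniusPushforward.of p 1 S).surjective x
        rw [FrobeniusPushforward.smul_def, AddEquiv.symm_apply_apply, AddEquiv.symm_apply_apply,
          FrobeniusPushforward.smul_def, map_mul, map_pow] }
  have : RingHomSurjective (Ideal.Quotient.mk J) := ⟨Ideal.Quotient.mk_surjective⟩
  exact Module.Finite.of_surjective f ((FrobeniusPushforward.of p 1 (S ⧸ J)).surjective.comp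
    (Ideal.Quotient.mk_surjective.comp (FrobeniusPushforward.of p 1 S).symm.surjective))

theorem rpow_mul_frobeniusAlpha {p : ℕ} [Fact p.Prime] {R : Type*} [CommRing R] [IsLocalRing R]
    [CharP R p] (h : IsFFinite p R) (e : ℕ) :
    (p : ℝ) ^ ((e : ℝ) * frobeniusAlpha p R) = (residueFrobeniusDegree p R : ℝ) ^ e := by
  have hp : p.Prime := Fact.out
  have hpos := residueFrobeniusDegree_pos p R h
  rw [mul_comm, Real.rpow_mul (by positivity), Real.rpow_natCast, frobeniusAlpha,
    Real.rpow_logb (by exact_mod_cast hp.pos) (by exact_mod_cast hp.one_lt.ne')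
      (by exact_mod_cast hpos)]

theorem fSplittingNumber_eq_mul {p : ℕ} [Fact p.Prime] {R : Type*} [CommRing R] [IsLocalRing R]
    [CharP R p] (h : IsFFinite p R) (e : ℕ) :
    fSplittingNumber p e R = splittingLength p R e * residueFrobeniusDegree p R ^ e := by
  have := fSplittingNumber_eq_length p e R h
  rw [← coe_splittingLength p h] at this
  exact_mod_cast this

end Main

theorem corollary4p10 (p : ℕ) [Fact p.Prime] (S : Type*) [CommRing S] [IsRegularLocalRing S]
    [CharP S p] (hS : IsFFinite p S) (J : Ideal S) [Nontrivial (S ⧸ J)]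
    (d : ℕ) (hd : ringKrullDim (S ⧸ J) = d) :
    (∀ e : ℕ, 0 < e →
      Module.length S (S ⧸ fedderIdeal p e J) ≠ ⊤ ∧
      (fSplittingNumber p e (S ⧸ J) : ℝ) / (p : ℝ) ^ ((e : ℝ) * frobeniusAlpha p (S ⧸ J)) =
        (Module.length S (S ⧸ fedderIdeal p e J)).toNat ∧
      Module.length S (S ⧸ fedderIdeal p e J) = Module.length S (FedderQuotient p e J)) ∧
    ∃ s : ℝ, IsFSignature p (S ⧸ J) s ∧
      Tendsto (fun e : ℕ =>
        ((Module.length S (S ⧸ fedderIdeal p e J)).toNat : ℝ) / (p : ℝ) ^ (e * d)) atTop (𝓝 s) ∧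
      Tendsto (fun e : ℕ =>
        ((Module.length S (FedderQuotient p e J)).toNat : ℝ) / (p : ℝ) ^ (e * d)) atTop (𝓝 s) := by
  have hR : IsFFinite p (S ⧸ J) := hS.quotient J
  have hp : p.Prime := Fact.out
  have hp0 : (0 : ℝ) < p := by exact_mod_cast hp.pos
  have hκ : (0 : ℝ) < residueFrobeniusDegree p (S ⧸ J) := by
    exact_mod_cast residueFrobeniusDegree_pos p (S ⧸ J) hR
  have hlen : ∀ e, Module.length S (S ⧸ fedderIdeal p e J) = splittingLength p (S ⧸ J) e :=
    fun e => by rw [length_quotient_fedderIdeal p e S J hS, coe_splittingLength p hR]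
  have ha : ∀ e : ℕ, (fSplittingNumber p e (S ⧸ J) : ℝ) /
      (p : ℝ) ^ ((e : ℝ) * frobeniusAlpha p (S ⧸ J)) = splittingLength p (S ⧸ J) e := fun e => by
    rw [rpow_mul_frobeniusAlpha hR, fSplittingNumber_eq_mul hR, Nat.cast_mul, Nat.cast_pow,
      mul_div_cancel_right₀ _ (pow_pos hκ e).ne']
  have hfq : ∀ e, Module.length S (S ⧸ fedderIdeal p e J) =
      Module.length S (FedderQuotient p e J) :=
    fun e => length_fedderQuotient p e S J hS
  refine ⟨fun e _ => ⟨hlen e ▸ ENat.natCast_ne_top _, ?_, hfq e⟩, ?_⟩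
  · rw [ha, hlen, ENat.toNat_natCast]
  obtain ⟨s, hs⟩ := exists_tendsto_splittingLength p hR d hd
  refine ⟨s, ⟨d, hd, hs.congr fun e => ?_⟩, ?_, ?_⟩
  -- The factor `p ^ (e (d + α))` splits into `p ^ (e α)`, which turns `a_e` into a length, and `p ^
  -- (e d)`.
  · rw [← ha, div_div, ← Real.rpow_natCast, ← Real.rpow_add hp0]
    congr 2
    push_cast
    ring
  · simpa only [hlen, ENat.toNat_natCast] using hs
  · simpa only [← hfq, hlen, ENat.toNat_natCast] using hs
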